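/- **Setting.** Let $L\ge 2$, let $\xi_1,\dots,\xi_m\in\mathbb R^d$ be distinct training inputs with labels $y_1,\dots,y_m\in\mathbb R$, let $\eta>0$ be a learning rate, let $\mathcal L(f,y)$ be a loss that is continuously differentiable in $f$ with derivative $\mathcal L'(f,y)$, let $\mathcal B_t\subseteq\{1,\dots,m\}$ be an arbitrary sequence of mini-batches ($\mathcal B_t=\{1,\dots,m\}$ is full-batch gradient descent), and let $\phi:\mathbb R\to\mathbb R$ be the activation. The infinite-width MLP with $L$ hidden layers, trained by (S)GD under the maximal update parametrization $\mu$P, is described by the following random variables, built recursively in time ($t=0,1,2,\dots$) and, at each time, by a forward pass followed by a backward pass. All hatted variables are centred Gaussian; the families belonging to different matrices, or to a matrix and its transpose, are independent of each other and of $Z^{h_0^1}$ and $Z^{\widehat W_0^{L+1}}$. Put $x_t^l=\phi(h_t^l)$, i.e. $Z^{x_t^l(\xi_i)}=\phi(Z^{h_t^l(\xi_i)})$, $\delta z_t=z_t-z_{t-1}$ for $t\ge1$ and $\delta x_0=x_0$. * *Initialization.* $(Z^{h_0^1(\xi_i)})_i$ is centred Gaussian with covariance $\langle \xi_i,\xi_j\rangle$;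 $Z^{h_0^l(\xi_i)}=\hat Z^{W_0^l\delta x_0^{l-1}(\xi_i)}$ for $2\le l\le L$; $Z^{\widehat W_0^{L+1}}\sim N(0,1)$; $\mathring f_0=0$. * *Gaussian covariances.* For $2\le l\le L$, $\mathrm{Cov}(\hat Z^{W_0^l\delta x_s^{l-1}(\xi_i)},\hat Z^{W_0^l\delta x_r^{l-1}(\xi_j)})=\mathbb E Z^{\delta x_s^{l-1}(\xi_i)}Z^{\delta x_r^{l-1}(\xi_j)}$ and $\mathrm{Cov}(\hat Z^{W_0^{l\top}dh_s^l(\xi_i)},\hat Z^{W_0^{l\top}dh_r^l(\xi_j)})=\mathbb E Z^{dh_s^l(\xi_i)}Z^{dh_r^l(\xi_j)}$. * *Forward pass, $t\ge1$.* $Z^{\delta h_t^1(\xi)}=-\eta\sum_j\mathring\chi_{t-1,j}\langle\xi_j,\xi\rangle Z^{dh_{t-1}^1(\xi_j)}$, and for $2\le l\le L$ $$Z^{\delta h_t^l(\xi)}=\hat Z^{W_0^l\delta x_t^{l-1}(\xi)}+\sum_{s=0}^{t-1}\sum_j Z^{dh_s^l(\xi_j)}\,\mathbb E\frac{\partial Z^{\delta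 x_t^{l-1}(\xi)}}{\partial \hat Z^{W_0^{l\top}dh_s^l(\xi_j)}}-\eta\sum_j\mathring\chi_{t-1,j}Z^{dh_{t-1}^l(\xi_j)}\,\mathbb E Z^{x_{t-1}^{l-1}(\xi_j)}Z^{x_t^{l-1}(\xi)}-\eta\sum_{s=0}^{t-2}\sum_j\mathring\chi_{s,j}Z^{dh_s^l(\xi_j)}\,\mathbb E Z^{x_s^{l-1}(\xi_j)}Z^{\delta x_t^{l-1}(\xi)} .$$ * *Output and error signal.* $Z^{\delta\widehat W_t^{L+1}}=-\eta\sum_j\mathring\chi_{t-1,j}Z^{x_{t-1}^L(\xi_j)}$, $\delta\mathring f_t(\xi)=\mathbb E Z^{\delta\widehat W_t^{L+1}}Z^{x_t^L(\xi)}+\mathbb E Z^{\widehat W_{t-1}^{L+1}}Z^{\delta x_t^L(\xi)}$, and $\mathring\chi_{t,i}=\mathcal L'(\mathring f_t(\xi_i),y_i)\mathbf 1\{i\in\mathcal B_t\}$. * *Backward pass.* $Z^{dx_t^L(\xi)}=Z^{\widehat W_t^{L+1}}$, $Z^{dh_t^l(\xi)}=Z^{dx_t^l(\xi)}\phi'(Z^{h_t^l(\xi)})$,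 and for $2\le l\le L$ $$Z^{dx_t^{l-1}(\xi)}=\hat Z^{W_0^{l\top}dh_t^l(\xi)}+\sum_{s=0}^{t}\sum_j Z^{\delta x_s^{l-1}(\xi_j)}\,\mathbb E\frac{\partial Z^{dh_t^l(\xi)}}{\partial\hat Z^{W_0^l\delta x_s^{l-1}(\xi_j)}}-\eta\sum_{s=0}^{t-1}\sum_j\mathring\chi_{s,j}Z^{x_s^{l-1}(\xi_j)}\,\mathbb E Z^{dh_s^l(\xi_j)}Z^{dh_t^l(\xi)} .$$ The partial derivatives are those of the variables written, through this recursion, as functions of the Gaussian variables. **Assumptions.** (Data) $|\langle\xi_i,\xi_j\rangle|\ne|\langle\xi_i,\xi_k\rangle|$ for three different points, and $\langle\xi_i,\xi_j\rangle\ne0$ for $i\ne j$; moreover no $\xi_i$ is $0$ and $\xi_i\ne-\xi_j$ for $i\ne j$ (both automatic if $m\ge3$). (Activation) $\phi$ is $C^2$ with bounded $\phi'$ and $\phi''$; all level sets of $\phi$ and of $\phi'$ are countable; and $\phi$ is GOOD: (a) for all finite families $(a_i),(b_i),(c_i)$ with $a_kb_k\neq0$ for some $k$ and $|b_i|\ne|b_j|$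 for $i\ne j$, the function $x\mapsto\sum_ia_i\phi(b_ix+c_i)$ is not constant; (b) for all real $r_1,r_2$ the function $(r_1+\phi)(r_2+\phi')$ is not almost everywhere constant. **Theorem.** At every time $t\ge0$: 1. for every layer $2\le l\le L$ the pre-activation features $\{Z^{h_t^l(\xi_i)}\}_{i\le m}$ are linearly independent (if $\sum_ic_iZ^{h_t^l(\xi_i)}=0$ almost surely then all $c_i=0$); for $l=1$ the same holds whenever the inputs $\xi_1,\dots,\xi_m$ are linearly independent vectors of $\mathbb R^d$; 2. for every layer $1\le l\le L$ the post-activation features $\{Z^{x_t^l(\xi_i)}\}_{i\le m}$ are linearly independent. -/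

import Mathlib

open MeasureTheory ProbabilityTheory

/-- A training problem for an MLP with `depth` hidden layers: activation `φ`, loss
`loss f y` (output, label), learning rate `η`, training inputs `input i = ξ_i` with
labels `label i = y_i`, and the index set `batch t = 𝓑_t` of the mini-batch used at step `t`
(full-batch gradient descent is `batch t = Finset.univ`). -/
structure TrainingSetup (d m : ℕ) where
  depth : ℕ
  φ : ℝ → ℝ
  loss : ℝ → ℝ → ℝ
  η : ℝ
  input : Fin m → EuclideanSpace ℝ (Fin d)
  label : Fin m → ℝ
  batch : ℕ → Finset (Fin m)

/-! ### Assumptions on the activation and on the data -/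

/-- `GOOD` functions: (a) no finite combination `∑ a_i φ(b_i x + c_i)` with pairwise distinct
`|b_i|` and some `a_k b_k ≠ 0` is constant; (b) no product `(r₁ + φ)(r₂ + φ')` is almost
everywhere constant. -/
def IsGood (φ : ℝ → ℝ) : Prop :=
  (∀ (n : ℕ) (a b c : Fin n → ℝ), (∃ k, a k * b k ≠ 0) →
    (∀ i j, i ≠ j → |b i| ≠ |b j|) →
    ¬ ∃ C : ℝ, ∀ x : ℝ, ∑ i, a i * φ (b i * x + c i) = C) ∧
  (∀ r₁ r₂ : ℝ, ¬ ∃ C : ℝ, ∀ᵐ x : ℝ, (r₁ + φ x) * (r₂ + deriv φ x) = C)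

/-- The assumption on the activation: `C²`, bounded `φ'` and `φ''`, `GOOD`, and countable level
sets of `φ` and `φ'`. -/
structure ActivationAssumption (φ : ℝ → ℝ) : Prop where
  contDiff : ContDiff ℝ 2 φ
  bounded_deriv : ∃ C : ℝ, ∀ x, |deriv φ x| ≤ C
  bounded_deriv_two : ∃ C : ℝ, ∀ x, |deriv (deriv φ) x| ≤ C
  good : IsGood φ
  countable_level : ∀ y : ℝ, {x | φ x = y}.Countable
  countable_level_deriv : ∀ y : ℝ, {x | deriv φ x = y}.Countable

/-- The assumption on the (pairwise distinct) data points: for three different points the two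
absolute inner products with the first one differ, and inner products of different points are
nonzero. -/
structure DataAssumption {d m : ℕ} (ξ : Fin m → EuclideanSpace ℝ (Fin d)) : Prop where
  injective : Function.Injective ξ
  abs_inner_ne : ∀ i j k, i ≠ j → i ≠ k → j ≠ k → |inner ℝ (ξ i) (ξ j)| ≠ |inner ℝ (ξ i) (ξ k)|
  abs_inner_ne_zero : ∀ i j, i ≠ j → |inner ℝ (ξ i) (ξ j)| ≠ 0

noncomputable section

namespace TrainingSetup

/-! ### The Gaussian variables of one layer

In the infinite-width limit every `Z`-variable of layer `l` is an explicit function of the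
Gaussian variables attached to that layer. A point `ω` of `Noise m` lists their values:

* `ω.1 s i` is `Ẑ^{W₀^l δx_s^{l-1}(ξ_i)}` (for `l = 1` and `s = 0` it is `Z^{h_0^1(ξ_i)}`);
* `ω.2.1 s i` is `Ẑ^{(W₀^{l+1})ᵀ dh_s^{l+1}(ξ_i)}` (for `l < L`);
* `ω.2.2` is `Z^{Ŵ₀^{L+1}}` (used in the last layer `l = L` only).

The three groups are independent of each other. Different layers interact only through
deterministic scalars (covariances, expected derivatives and error signals). -/

abbrev Noise (m : ℕ) := (ℕ → Fin m → ℝ) × (ℕ → Fin m → ℝ) × ℝ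

/-- Law of a centred jointly Gaussian family `(g_{s,i})` over times `s < n` with covariance `K`;
coordinates at times `s ≥ n` are set to `0`. -/
def gaussianFamily {m : ℕ} (n : ℕ) (K : Fin n × Fin m → Fin n × Fin m → ℝ) :
    Measure (ℕ → Fin m → ℝ) :=
  (multivariateGaussian 0 (Matrix.of K)).map
    (fun g s i => if hs : s < n then g (⟨s, hs⟩, i) else 0)

/-- Joint law of the Gaussian variables of a layer: forward ones at times `< n` with covariance
`K`, backward ones at times `< n'` with covariance `K'`, and a standard normal variable. -/
def noiseLaw {m : ℕ} (n n' : ℕ) (K : Fin n × Fin m → Fin n × Fin m → ℝ)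
    (K' : Fin n' × Fin m → Fin n' × Fin m → ℝ) : Measure (Noise m) :=
  (gaussianFamily n K).prod ((gaussianFamily n' K').prod (gaussianReal 0 1))

/-- Partial derivative with respect to the forward Gaussian with index `(s, j)`. -/
def dForward {m : ℕ} (s : ℕ) (j : Fin m) (F : Noise m → ℝ) (ω : Noise m) : ℝ :=
  lineDeriv ℝ F ω (Pi.single s (Pi.single j 1), 0, 0)

/-- Partial derivative with respect to the backward Gaussian with index `(s, j)`. -/
def dBackward {m : ℕ} (s : ℕ) (j : Fin m) (F : Noise m → ℝ) (ω : Noise m) : ℝ :=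
  lineDeriv ℝ F ω (0, Pi.single s (Pi.single j 1), 0)

/-- Lexicographic order on (time, phase, rank), used for the termination of the recursion below. -/
theorem lex_of {a b c a' b' c' : ℕ} (h : a < a' ∨ a = a' ∧ (b < b' ∨ b = b' ∧ c < c')) :
    (WellFoundedRelation.rel : ℕ × ℕ × ℕ → ℕ × ℕ × ℕ → Prop) (a, b, c) (a', b', c') := by
  rcases h with h | ⟨rfl, h | ⟨rfl, h⟩⟩
  · exact Prod.Lex.left _ _ h
  · exact Prod.Lex.right _ (Prod.Lex.left _ _ h)
  · exact Prod.Lex.right _ (Prod.Lex.right _ h)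

variable {d m : ℕ} (S : TrainingSetup d m)

/-! ### The infinite-width dynamics under `μP`

Time is the first argument, the layer the second, the sample the last. Layers are `1, …, L` with
`L = S.depth`. Each quantity at time `t` is computed from earlier times, and at time `t` in the
order of training: forward pass, output and error signal, backward pass. -/

mutual

/-- `Cov(Ẑ^{W₀^l δx_s^{l-1}(ξ_i)}, Ẑ^{W₀^l δx_r^{l-1}(ξ_j)}) = 𝔼 Z^{δx_s^{l-1}(ξ_i)} Z^{δx_r^{l-1}(ξ_j)}`
for `l ≥ 2`. In layer `1` the only Gaussians are `Z^{h_0^1(ξ_i)}`, with covariance `⟨ξ_i, ξ_j⟩`. -/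
def covForward (l s : ℕ) (i : Fin m) (r : ℕ) (j : Fin m) : ℝ :=
  match l with
  | 0 => 0
  | 1 => if s = 0 ∧ r = 0 then inner ℝ (S.input i) (S.input j) else 0
  | k + 2 => ∫ ω, Zδx s (k + 1) i ω * Zδx r (k + 1) j ω ∂lawForward (max s r) (k + 1)
termination_by (max s r, 0, 4 * l)
decreasing_by all_goals (refine lex_of ?_; omega)

/-- Law of the Gaussians of layer `l` that are present after the forward pass at time `t`:
forward ones at times `≤ t`, backward ones at times `< t`. -/
def lawForward (t l : ℕ) : Measure (Noise m) :=
  noiseLaw (t + 1) t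
    (fun p q => covForward l p.1.val p.2 q.1.val q.2)
    (fun p q => covBackward l p.1.val p.2 q.1.val q.2)
termination_by (t, 0, 4 * l + 1)
decreasing_by all_goals (refine lex_of ?_; omega)

/-- The pre-activation `Z^{h_t^l(ξ_i)} = Z^{h_0^l(ξ_i)} + Z^{δh_1^l(ξ_i)} + ⋯ + Z^{δh_t^l(ξ_i)}`. -/
def Zh (t l : ℕ) (i : Fin m) (ω : Noise m) : ℝ :=
  match t with
  | 0 => ω.1 0 i
  | t' + 1 =>
    Zh t' l i ω +
    match l with
    | 0 => 0
    | 1 => - ∑ j, S.η * χ t' j * inner ℝ (S.input j) (S.input i) * Zdh t' 1 j ω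
    | k + 2 =>
      -- `Ẑ^{W₀ δx_{t'+1}}`
      ω.1 (t' + 1) i
      -- `Ż^{W₀ δx_{t'+1}}`
      + ∑ s : Fin (t' + 1), ∑ j,
          Zdh s.val (k + 2) j ω *
            ∫ ω', dBackward s.val j (fun ω'' => Zδx (t' + 1) (k + 1) i ω'') ω'
              ∂lawForward (t' + 1) (k + 1)
      -- contribution of the latest weight update to `x_{t'+1}`
      - S.η * ∑ j, χ t' j * Zdh t' (k + 2) j ω *
          ∫ ω', Zx t' (k + 1) j ω' * Zx (t' + 1) (k + 1) i ω' ∂lawForward (t' + 1) (k + 1)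
      -- contribution of the earlier weight updates to `δx_{t'+1}`
      - S.η * ∑ s : Fin t', ∑ j, χ s.val j * Zdh s.val (k + 2) j ω *
          ∫ ω', Zx s.val (k + 1) j ω' * Zδx (t' + 1) (k + 1) i ω' ∂lawForward (t' + 1) (k + 1)
termination_by (t, 0, 4 * l + 2)
decreasing_by all_goals (refine lex_of ?_; omega)

/-- The post-activation `Z^{x_t^l(ξ_i)} = φ(Z^{h_t^l(ξ_i)})`. -/
def Zx (t l : ℕ) (i : Fin m) (ω : Noise m) : ℝ := S.φ (Zh t l i ω)
termination_by (t, 0, 4 * l + 3)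
decreasing_by all_goals (refine lex_of ?_; omega)

/-- `Z^{δx_t^l(ξ_i)} = φ(Z^{h_t^l(ξ_i)}) - φ(Z^{h_{t-1}^l(ξ_i)})`, and `δx_0 = x_0`. -/
def Zδx (t l : ℕ) (i : Fin m) (ω : Noise m) : ℝ :=
  match t with
  | 0 => S.φ (Zh 0 l i ω)
  | t' + 1 => S.φ (Zh (t' + 1) l i ω) - S.φ (Zh t' l i ω)
termination_by (t, 0, 4 * l + 3)
decreasing_by all_goals (refine lex_of ?_; omega)

/-- The last-layer weight `Z^{Ŵ_t^{L+1}}`. -/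
def ZŴ (t : ℕ) (ω : Noise m) : ℝ :=
  match t with
  | 0 => ω.2.2
  | t' + 1 => ZŴ t' ω - S.η * ∑ i, χ t' i * Zx t' S.depth i ω
termination_by (t, 1, 0)
decreasing_by all_goals (refine lex_of ?_; omega)

/-- The limiting output `f̊_t(ξ_i) = δf̊_1(ξ_i) + ⋯ + δf̊_t(ξ_i)`, where
`δf̊_t = 𝔼 Z^{δŴ_t} Z^{x_t^L} + 𝔼 Z^{Ŵ_{t-1}} Z^{δx_t^L}`. -/
def output (t : ℕ) (i : Fin m) : ℝ :=
  match t with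
  | 0 => 0
  | t' + 1 =>
    output t' i
    + (∫ ω, (- S.η * ∑ j, χ t' j * Zx t' S.depth j ω) * Zx (t' + 1) S.depth i ω
        ∂lawForward (t' + 1) S.depth)
    + ∫ ω, ZŴ t' ω * Zδx (t' + 1) S.depth i ω ∂lawForward (t' + 1) S.depth
termination_by (t, 1, 1)
decreasing_by all_goals (refine lex_of ?_; omega)

/-- The error signal `χ̊_{t,i} = 𝓛'(f̊_t(ξ_i), y_i) 1{i ∈ 𝓑_t}`. -/
def χ (t : ℕ) (i : Fin m) : ℝ :=
  if i ∈ S.batch t then deriv (fun z => S.loss z (S.label i)) (output t i) else 0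
termination_by (t, 1, 2)
decreasing_by all_goals (refine lex_of ?_; omega)

/-- `Cov(Ẑ^{(W₀^{l+1})ᵀ dh_s^{l+1}(ξ_i)}, Ẑ^{(W₀^{l+1})ᵀ dh_r^{l+1}(ξ_j)})
= 𝔼 Z^{dh_s^{l+1}(ξ_i)} Z^{dh_r^{l+1}(ξ_j)}` for `l < L`. There are no such Gaussians for `l ≥ L`. -/
def covBackward (l s : ℕ) (i : Fin m) (r : ℕ) (j : Fin m) : ℝ :=
  if l < S.depth then
    ∫ ω, Zdh s (l + 1) i ω * Zdh r (l + 1) j ω ∂lawBackward (max s r) (l + 1)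
  else 0
termination_by (max s r, 2, 4 * (S.depth - l))
decreasing_by all_goals (refine lex_of ?_; omega)

/-- Law of the Gaussians of layer `l` that are present once the backward pass at time `t` has
reached layer `l`: forward and backward ones at times `≤ t`. -/
def lawBackward (t l : ℕ) : Measure (Noise m) :=
  noiseLaw (t + 1) (t + 1)
    (fun p q => covForward l p.1.val p.2 q.1.val q.2)
    (fun p q => covBackward l p.1.val p.2 q.1.val q.2)
termination_by (t, 2, 4 * (S.depth - l) + 1)
decreasing_by all_goals (refine lex_of ?_; omega)

/-- The backward variable `Z^{dx_t^l(ξ_i)}`: `Z^{Ŵ_t^{L+1}}` in the last layer, and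
`Z^{(W_t^{l+1})ᵀ dh_t^{l+1}(ξ_i)}` for `l < L`. -/
def Zdx (t l : ℕ) (i : Fin m) (ω : Noise m) : ℝ :=
  if l < S.depth then
    -- `Ẑ^{W₀ᵀ dh_t}`
    ω.2.1 t i
    -- `Ż^{W₀ᵀ dh_t}`
    + ∑ s : Fin (t + 1), ∑ j,
        Zδx s.val l j ω *
          ∫ ω', dForward s.val j (fun ω'' => Zdh t (l + 1) i ω'') ω' ∂lawBackward t (l + 1)
    -- contribution of the weight updates
    - S.η * ∑ s : Fin t, ∑ j, χ s.val j * Zx s.val l j ω *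
        ∫ ω', Zdh s.val (l + 1) j ω' * Zdh t (l + 1) i ω' ∂lawBackward t (l + 1)
  else ZŴ t ω
termination_by (t, 2, 4 * (S.depth - l) + 2)
decreasing_by all_goals (refine lex_of ?_; omega)

/-- The backward variable `Z^{dh_t^l(ξ_i)} = Z^{dx_t^l(ξ_i)} φ'(Z^{h_t^l(ξ_i)})`. -/
def Zdh (t l : ℕ) (i : Fin m) (ω : Noise m) : ℝ :=
  Zdx t l i ω * deriv S.φ (Zh t l i ω)
termination_by (t, 2, 4 * (S.depth - l) + 3)
decreasing_by all_goals (refine lex_of ?_; omega)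

end

end TrainingSetup

end

/-- Linear independence of finitely many real random variables on `(Ω, μ)`, as elements of the
space of functions modulo almost sure equality: `∑ c_i Z_i = 0` a.s. implies `c = 0`. -/
def AELinearIndependent {Ω ι : Type*} [MeasurableSpace Ω] (μ : Measure Ω) (Z : ι → Ω → ℝ) : Prop :=
  LinearIndependent ℝ (fun i => (Z i : (ae μ).Germ ℝ))

/-!
In every layer the variables of the recursion are explicit continuous functions of Gaussian
variables, and all expectations in the recursion only contribute deterministic scalars. The proof
does not evaluate these scalars: whatever they are, each new pre-activation above the first layer
is a *fresh Gaussian plus a function of earlier variables*, each new `Z^{dx}` below the last layer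
likewise, and linear relations are excluded by moving the fresh Gaussian alone.

*From almost sure to pointwise.* The covariances are Gram matrices of square integrable variables
of a neighbouring layer (`covForward_eq_integral`, `covBackward_eq_integral`), so they are positive
semidefinite, and a continuous function that vanishes almost surely vanishes on the range of the
covariance operators (`eq_zero_of_ae_law`). If the variables of the neighbouring layers are linearly
independent, this range is as large as one can expect (`eq_zero_of_admissible`).

*Degenerate steps.* A step `t → t + 1` at which all error signals vanish moves no feature: its drift
vanishes identically and its fresh forward Gaussians are almost surely zero (`idle_step`). Moreover
no forward variable depends on the backward Gaussians of such a step (`driftCoef_of_not_active`).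
So only forward Gaussians at *fresh* times (`0` and the times following an active step) and backward
Gaussians at *active* times matter, and at those the covariances are nondegenerate. The points where
relations have to be tested are the `Admissible` ones.

*Excluding relations at admissible points.* In a relation among `δx_s^l`, `s ≤ n`, with `l ≥ 2`, the
Gaussians at time `n` make `h_n^l` arbitrary, and `φ` is not constant. In a relation among `dh_s^l`
with `l < L`, the backward Gaussians at time `n` make `dx_n^l` arbitrary, and `φ'` does not vanish
identically. For `l = L`, `dh_n^L` is the last-layer weight times `φ'(h_n^L)`; the weight is nonzero
at some point, `h_n^L` can then be moved without changing it, and `φ'` is not constant. For `l = 1`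
the backward Gaussians are chosen so that all backward variables vanish before time `n`, hence
`h^1(ξ_i) = ⟨ξ_i, θ⟩` there; moving one of them, with a nonzero error signal at `ξ_j`, gives
`∑ c_i ⟨ξ_j, ξ_i⟩ φ'(⟨ξ_i, θ⟩) = 0` whenever `φ'(⟨ξ_j, θ⟩) ≠ 0`. On a generic line `x ↦ x θ'`, for
which the `|⟨ξ_i, θ'⟩|` are nonzero and distinct, this holds everywhere by density, and integrating
it contradicts property (a) of GOOD functions (`eq_zero_of_sum_deriv_activation_inner`).

The nondegeneracy of all covariances then follows by induction in the order of training: over time,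
and at each time forward through the layers (`nondegForward_step`) and backward
(`nondegBackward_step`).
-/

/-! ### Gaussian measures with full support and their marginals -/

open scoped MatrixOrder in
theorem matrix_posSemidef_sqrt_mul_self {ι : Type*} [Fintype ι] [DecidableEq ι]
    {S : Matrix ι ι ℝ} (hS : S.PosSemidef) : CFC.sqrt S * CFC.sqrt S = S :=
  CFC.sqrt_mul_sqrt_self _ hS.nonneg

instance isOpenPosMeasure_gaussianReal_zero_one : (gaussianReal 0 1).IsOpenPosMeasure :=
  (gaussianReal_absolutelyContinuous' 0 one_ne_zero).isOpenPosMeasure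

instance isOpenPosMeasure_stdGaussian {ι : Type*} [Fintype ι] :
    (stdGaussian (EuclideanSpace ℝ ι)).IsOpenPosMeasure := by
  rw [← map_pi_eq_stdGaussian]
  exact (PiLp.continuous_toLp 2 _).isOpenPosMeasure_map (WithLp.toLp_surjective 2)

/-- A submatrix of the covariance matrix gives the law of the corresponding coordinates. -/
theorem map_submatrix_multivariateGaussian {ι κ : Type*} [Fintype ι] [Fintype κ] [DecidableEq ι]
    [DecidableEq κ] {S : Matrix ι ι ℝ} (hS : S.PosSemidef) (e : κ → ι) :
    (multivariateGaussian 0 S).map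
      (fun g => (WithLp.toLp 2 (fun k => g (e k)) : EuclideanSpace ℝ κ)) =
      multivariateGaussian 0 (S.submatrix e e) := by
  let T : EuclideanSpace ℝ ι →L[ℝ] EuclideanSpace ℝ κ :=
    LinearMap.toContinuousLinearMap
      { toFun := fun g => WithLp.toLp 2 (fun k => g (e k))
        map_add' := fun _ _ => rfl
        map_smul' := fun _ _ => rfl }
  change (multivariateGaussian 0 S).map T = _
  apply IsGaussian.ext
  · simp only [id_eq, integral_id_multivariateGaussian]
    rw [ContinuousLinearMap.integral_id_map, integral_id_multivariateGaussian, map_zero]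
    exact IsGaussian.integrable_id
  rw [← ContinuousLinearMap.toBilinForm_inj]
  refine LinearMap.BilinForm.ext_basis (EuclideanSpace.basisFun κ ℝ).toBasis fun i j ↦ ?_
  rw [ContinuousLinearMap.toBilinForm_apply, ContinuousLinearMap.toBilinForm_apply,
    covarianceBilin_apply_eq_cov, covariance_map]
  · have (i : κ) : (fun u ↦ inner ℝ ((EuclideanSpace.basisFun κ ℝ).toBasis i) u) ∘
        T = fun u ↦ u (e i) := by
      ext u
      simp only [OrthonormalBasis.coe_toBasis, Function.comp_apply,
        EuclideanSpace.basisFun_inner]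
      rfl
    simp_rw [this, covariance_eval_multivariateGaussian hS,
      covarianceBilin_multivariateGaussian (hS.submatrix _)]
    simp
  any_goals exact Measurable.aestronglyMeasurable (by fun_prop)
  · fun_prop
  · exact IsGaussian.memLp_two_id

/-! ### Consequences of the assumptions on the activation and the data -/

theorem exists_ne_of_countable_level {g : ℝ → ℝ} (hg : ∀ y, {x | g x = y}.Countable) (y : ℝ) :
    ∃ x, g x ≠ y := by
  by_contra! h
  refine Set.not_countable_univ (α := ℝ) ?_
  rw [← Set.eq_univ_of_forall (s := {x | g x = y}) h]
  exact hg y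

theorem eq_zero_of_sum_comp_eq_const {ι : Type*} [Fintype ι] {g : ℝ → ℝ} {a b : ℝ}
    (hab : g a ≠ g b) {c : ι → ℝ} {K : ℝ} (h : ∀ y : ι → ℝ, ∑ i, c i * g (y i) = K) : c = 0 := by
  classical
  ext i
  have h1 := (h (Function.update (fun _ => b) i a)).trans (h fun _ => b).symm
  rw [← sub_eq_zero, ← Finset.sum_sub_distrib, Finset.sum_eq_single i] at h1
  · rw [Function.update_self, ← mul_sub] at h1
    exact (mul_eq_zero.1 h1).resolve_right (sub_ne_zero.2 hab)
  · intro j _ hj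
    rw [Function.update_of_ne hj, sub_self]
  · simp

section Inputs

variable {d m : ℕ} {ξ : Fin m → EuclideanSpace ℝ (Fin d)} {φ : ℝ → ℝ}

/-- A generic direction separates nonzero, pairwise non-antipodal, distinct points up to sign. -/
theorem exists_generic_direction (hinj : Function.Injective ξ) (h0 : ∀ i, ξ i ≠ 0)
    (ha : ∀ i j, i ≠ j → ξ i ≠ - ξ j) :
    ∃ θ, (∀ i, inner ℝ (ξ i) θ ≠ 0) ∧
      ∀ i j, i ≠ j → |inner ℝ (ξ i) θ| ≠ |inner ℝ (ξ j) θ| := by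
  let v : Fin m ⊕ {p : Fin m × Fin m // p.1 ≠ p.2} ⊕ {p : Fin m × Fin m // p.1 ≠ p.2} →
      EuclideanSpace ℝ (Fin d) :=
    Sum.elim ξ (Sum.elim (fun p => ξ p.1.1 - ξ p.1.2) (fun p => ξ p.1.1 + ξ p.1.2))
  have hv : ∀ x, v x ≠ 0 := by
    rintro (i | p | p)
    · exact h0 i
    · exact sub_ne_zero.2 (hinj.ne p.2)
    · exact fun h => ha _ _ p.2 (eq_neg_of_add_eq_zero_left h)
  obtain ⟨f, hf⟩ := Module.exists_dual_forall_apply_ne_zero (K := ℝ) v hv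
  let θ := (InnerProductSpace.toDual ℝ (EuclideanSpace ℝ (Fin d))).symm
    (LinearMap.toContinuousLinearMap f)
  have hθ (x : EuclideanSpace ℝ (Fin d)) : inner ℝ x θ = f x := by
    rw [real_inner_comm]
    exact InnerProductSpace.toDual_symm_apply
  refine ⟨θ, fun i => by rw [hθ]; exact hf (Sum.inl i), fun i j hij h => ?_⟩
  rw [hθ, hθ] at h
  rcases abs_eq_abs.1 h with h | h
  · refine hf (Sum.inr (Sum.inl ⟨(i, j), hij⟩)) ?_
    simp [v, h]
  · refine hf (Sum.inr (Sum.inr ⟨(i, j), hij⟩)) ?_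
    simp [v, h]

variable (hφ : ActivationAssumption φ) (hinj : Function.Injective ξ) (h0 : ∀ i, ξ i ≠ 0)
  (ha : ∀ i j, i ≠ j → ξ i ≠ - ξ j)
include hφ hinj h0 ha

theorem eq_zero_of_sum_activation_inner {a : Fin m → ℝ}
    (h : ∀ θ, ∑ i, a i * φ (inner ℝ (ξ i) θ) = 0) : a = 0 := by
  obtain ⟨θ, h1, h2⟩ := exists_generic_direction hinj h0 ha
  by_contra hne
  obtain ⟨k, hk⟩ := Function.ne_iff.1 hne
  refine hφ.good.1 m a (fun i => inner ℝ (ξ i) θ) 0 ⟨k, mul_ne_zero hk (h1 k)⟩ h2 ⟨0, fun x => ?_⟩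
  simpa [inner_smul_right, mul_comm] using h (x • θ)

/-- There is no linear relation among the functions `θ ↦ φ'(⟨ξ_i, θ⟩)`: along a generic line through
the origin it would integrate to a relation among dilates of `φ`. The relation is only assumed where
`φ'(⟨ξ_j, θ⟩) ≠ 0`, which on the line excludes countably many points. -/
theorem eq_zero_of_sum_deriv_activation_inner {a : Fin m → ℝ} (j : Fin m)
    (h : ∀ θ, deriv φ (inner ℝ (ξ j) θ) ≠ 0 → ∑ i, a i * deriv φ (inner ℝ (ξ i) θ) = 0) :
    a = 0 := by
  obtain ⟨θ, h1, h2⟩ := exists_generic_direction hinj h0 ha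
  set b : Fin m → ℝ := fun i => inner ℝ (ξ i) θ with hb
  have hb' (i : Fin m) (x : ℝ) : inner ℝ (ξ i) (x • θ) = b i * x := by
    rw [inner_smul_right, mul_comm]
  have hc' : Continuous (deriv φ) := hφ.contDiff.continuous_deriv one_le_two
  have hd : Differentiable ℝ φ := hφ.contDiff.differentiable two_ne_zero
  have hG : (fun x : ℝ => ∑ i, a i * deriv φ (b i * x)) = fun _ => 0 := by
    have hcount : {x : ℝ | deriv φ (b j * x) = 0}.Countable :=
      (hφ.countable_level_deriv 0).preimage_of_injOn
        (f := fun x => b j * x) (mul_right_injective₀ (h1 j)).injOn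
    refine Continuous.ext_on (hcount.dense_compl ℝ) ?_ continuous_const fun x hx => ?_
    · fun_prop
    · have := h (x • θ) (by rw [hb']; exact hx)
      simpa only [hb'] using this
  by_contra hne
  obtain ⟨k, hk⟩ := Function.ne_iff.1 hne
  have hder (x : ℝ) : HasDerivAt (fun x : ℝ => ∑ i, a i / b i * φ (b i * x)) 0 x := by
    have e : (0 : ℝ) = ∑ i, a i / b i * (deriv φ (b i * x) * (b i * 1)) := by
      rw [← congrFun hG x]
      refine Finset.sum_congr rfl fun i _ => ?_
      have hbi : b i ≠ 0 := h1 i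
      field_simp
    rw [e]
    refine HasDerivAt.fun_sum fun i _ => HasDerivAt.const_mul _ ?_
    exact (hd _).hasDerivAt.comp x ((hasDerivAt_id x).const_mul (b i))
  refine hφ.good.1 m (fun i => a i / b i) b 0 ⟨k, ?_⟩ h2
    ⟨∑ i, a i / b i * φ (b i * 0), fun x => ?_⟩
  · rwa [div_mul_cancel₀ _ (h1 k)]
  · simpa using is_const_of_deriv_eq_zero (fun x => (hder x).differentiableAt)
      (fun x => (hder x).deriv) x 0

end Inputs

/-! ### Linear independence modulo almost sure equality -/

theorem aeLinearIndependent_of_forall {Ω ι : Type*} [Fintype ι] [MeasurableSpace Ω]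
    {μ : Measure Ω} {Z : ι → Ω → ℝ}
    (h : ∀ c : ι → ℝ, (∀ᵐ ω ∂μ, ∑ i, c i * Z i ω = 0) → c = 0) : AELinearIndependent μ Z := by
  refine Fintype.linearIndependent_iff.2 fun c hc => congrFun (h c ?_)
  have h1 : (∑ i, c i • (Z i : (ae μ).Germ ℝ)) = ((fun ω => ∑ i, c i * Z i ω : Ω → ℝ) :
      (ae μ).Germ ℝ) := by
    have h2 (s : Finset ι) : (∑ i ∈ s, c i • (Z i : (ae μ).Germ ℝ)) =
        ((fun ω => ∑ i ∈ s, c i * Z i ω : Ω → ℝ) : (ae μ).Germ ℝ) := by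
      classical
      induction s using Finset.induction_on with
      | empty => simp; rfl
      | insert i s hi ih =>
        rw [Finset.sum_insert hi, ih]
        simp only [Finset.sum_insert hi]
        rfl
    exact h2 _
  rw [h1] at hc
  exact Filter.Germ.coe_eq.1 hc

noncomputable section

namespace TrainingSetup

variable {m : ℕ}

/-! ### The law of the noise of a layer -/

/-- The covariance matrix over times `< n` of a covariance function `k`. -/
def covMatrix (n : ℕ) (k : ℕ → Fin m → ℕ → Fin m → ℝ) :
    Matrix (Fin n × Fin m) (Fin n × Fin m) ℝ :=
  Matrix.of fun p q => k p.1.val p.2 q.1.val q.2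

theorem covMatrix_apply (n : ℕ) (k : ℕ → Fin m → ℕ → Fin m → ℝ) (p q : Fin n × Fin m) :
    covMatrix n k p q = k p.1.val p.2 q.1.val q.2 := rfl

/-- The joint law `noiseLaw` for covariance functions defined at all times. -/
def law (n n' : ℕ) (k k' : ℕ → Fin m → ℕ → Fin m → ℝ) : Measure (Noise m) :=
  noiseLaw n n' (fun p q => k p.1.val p.2 q.1.val q.2) (fun p q => k' p.1.val p.2 q.1.val q.2)

/-- Extension by zero of a family over times `< n`. -/
def pad (n : ℕ) (g : EuclideanSpace ℝ (Fin n × Fin m)) : ℕ → Fin m → ℝ :=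
  fun s i => if hs : s < n then g (⟨s, hs⟩, i) else 0

theorem pad_of_lt {n : ℕ} (g : EuclideanSpace ℝ (Fin n × Fin m)) {s : ℕ} (hs : s < n)
    (i : Fin m) : pad n g s i = g (⟨s, hs⟩, i) := dif_pos hs

theorem pad_of_le {n : ℕ} (g : EuclideanSpace ℝ (Fin n × Fin m)) {s : ℕ} (hs : n ≤ s)
    (i : Fin m) : pad n g s i = 0 := dif_neg (not_lt.2 hs)

@[fun_prop]
theorem continuous_pad (n : ℕ) : Continuous (pad (m := m) n) := by
  refine continuous_pi fun s => continuous_pi fun i => ?_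
  by_cases hs : s < n
  · simp only [pad_of_lt _ hs]; fun_prop
  · simp only [pad_of_le _ (not_lt.1 hs)]; fun_prop

theorem gaussianFamily_eq (n : ℕ) (k : ℕ → Fin m → ℕ → Fin m → ℝ) :
    gaussianFamily n (fun p q => k p.1.val p.2 q.1.val q.2) =
      (multivariateGaussian 0 (covMatrix n k)).map (pad n) := rfl

instance isProbabilityMeasure_gaussianFamily (n : ℕ) (k : ℕ → Fin m → ℕ → Fin m → ℝ) :
    IsProbabilityMeasure (gaussianFamily n (fun p q => k p.1.val p.2 q.1.val q.2)) := by
  rw [gaussianFamily_eq]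
  exact Measure.isProbabilityMeasure_map (continuous_pad n).measurable.aemeasurable

instance isProbabilityMeasure_law (n n' : ℕ) (k k' : ℕ → Fin m → ℕ → Fin m → ℝ) :
    IsProbabilityMeasure (law n n' k k') := by
  unfold law noiseLaw; infer_instance

open scoped MatrixOrder in
/-- The symmetric square root of the covariance matrix, as an operator. -/
def sqrtOp (n : ℕ) (k : ℕ → Fin m → ℕ → Fin m → ℝ) :
    EuclideanSpace ℝ (Fin n × Fin m) →L[ℝ] EuclideanSpace ℝ (Fin n × Fin m) :=
  Matrix.toEuclideanCLM (𝕜 := ℝ) (CFC.sqrt (covMatrix n k))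

theorem gaussianFamily_eq_map_std (n : ℕ) (k : ℕ → Fin m → ℕ → Fin m → ℝ) :
    gaussianFamily n (fun p q => k p.1.val p.2 q.1.val q.2) =
      (stdGaussian (EuclideanSpace ℝ (Fin n × Fin m))).map (fun x => pad n (sqrtOp n k x)) := by
  rw [gaussianFamily_eq, multivariateGaussian, Measure.map_map (continuous_pad n).measurable
    (by fun_prop)]
  simp only [zero_add]; rfl

/-- A continuous function that vanishes almost surely under the law of the noise vanishes on the
range of the covariance operators, since a standard Gaussian has full support. -/
theorem eq_zero_of_ae_law {n n' : ℕ} {k k' : ℕ → Fin m → ℕ → Fin m → ℝ} {F : Noise m → ℝ}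
    (hF : Continuous F) (h0 : ∀ᵐ ω ∂law n n' k k', F ω = 0)
    (x : EuclideanSpace ℝ (Fin n × Fin m)) (x' : EuclideanSpace ℝ (Fin n' × Fin m)) (w : ℝ) :
    F (pad n (sqrtOp n k x), pad n' (sqrtOp n' k' x'), w) = 0 := by
  have c1 : Continuous fun x => pad n (sqrtOp n k x) := by fun_prop
  have c2 : Continuous fun x => pad n' (sqrtOp n' k' x) := by fun_prop
  have hlaw : law n n' k k' =
      ((stdGaussian (EuclideanSpace ℝ (Fin n × Fin m))).prod
        ((stdGaussian (EuclideanSpace ℝ (Fin n' × Fin m))).prod (gaussianReal 0 1))).map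
        (Prod.map (fun x => pad n (sqrtOp n k x))
          (Prod.map (fun x => pad n' (sqrtOp n' k' x)) id)) := by
    rw [law, noiseLaw, gaussianFamily_eq_map_std, gaussianFamily_eq_map_std,
      ← Measure.map_prod_map _ _ c1.measurable (c2.prodMap continuous_id).measurable,
      ← Measure.map_prod_map _ _ c2.measurable measurable_id, Measure.map_id]
  have c3 := c1.prodMap (c2.prodMap (continuous_id (X := ℝ)))
  rw [hlaw] at h0
  have ho : ((stdGaussian (EuclideanSpace ℝ (Fin n × Fin m))).prod
      ((stdGaussian (EuclideanSpace ℝ (Fin n' × Fin m))).prod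
        (gaussianReal 0 1))).IsOpenPosMeasure := by
    have h1 : (stdGaussian (EuclideanSpace ℝ (Fin n × Fin m))).IsOpenPosMeasure :=
      inferInstance
    have h2 : (stdGaussian (EuclideanSpace ℝ (Fin n' × Fin m))).IsOpenPosMeasure :=
      inferInstance
    have h3 : ((stdGaussian (EuclideanSpace ℝ (Fin n' × Fin m))).prod
        (gaussianReal 0 1)).IsOpenPosMeasure := Measure.prod.instIsOpenPosMeasure
    exact Measure.prod.instIsOpenPosMeasure
  have h1 := ae_of_ae_map c3.measurable.aemeasurable h0
  have h2 := Continuous.ae_eq_iff_eq _ (hF.comp c3) (continuous_const (y := (0 : ℝ))) |>.1 h1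
  exact congrFun h2 (x, x', w)

theorem memLp_gaussianFamily_eval (n : ℕ) (k : ℕ → Fin m → ℕ → Fin m → ℝ) (s : ℕ) (i : Fin m) :
    MemLp (fun g => g s i) 2 (gaussianFamily n (fun p q => k p.1.val p.2 q.1.val q.2)) := by
  rw [gaussianFamily_eq]
  have hm : Measurable fun g : ℕ → Fin m → ℝ => g s i := by fun_prop
  rw [memLp_map_measure_iff hm.aestronglyMeasurable (continuous_pad n).measurable.aemeasurable]
  by_cases hs : s < n
  · have : (fun g : ℕ → Fin m → ℝ => g s i) ∘ pad n =
        (EuclideanSpace.proj (𝕜 := ℝ) ((⟨s, hs⟩, i) : Fin n × Fin m)) := by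
      ext g; simp [pad_of_lt _ hs]
    rw [this]
    exact IsGaussian.memLp_dual _ _ _ (by simp)
  · have : (fun g : ℕ → Fin m → ℝ => g s i) ∘ pad n = fun _ => 0 := by
      ext g; simp [pad_of_le _ (not_lt.1 hs)]
    rw [this]; exact memLp_const _

theorem memLp_law_forward (n n' : ℕ) (k k' : ℕ → Fin m → ℕ → Fin m → ℝ) (s : ℕ) (i : Fin m) :
    MemLp (fun ω : Noise m => ω.1 s i) 2 (law n n' k k') :=
  (memLp_gaussianFamily_eval n k s i).comp_measurePreserving measurePreserving_fst

theorem memLp_law_backward (n n' : ℕ) (k k' : ℕ → Fin m → ℕ → Fin m → ℝ) (s : ℕ) (i : Fin m) :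
    MemLp (fun ω : Noise m => ω.2.1 s i) 2 (law n n' k k') :=
  ((memLp_gaussianFamily_eval n' k' s i).comp_measurePreserving
    measurePreserving_fst).comp_measurePreserving measurePreserving_snd

theorem memLp_law_output (n n' : ℕ) (k k' : ℕ → Fin m → ℕ → Fin m → ℝ) :
    MemLp (fun ω : Noise m => ω.2.2) 2 (law n n' k k') :=
  ((IsGaussian.memLp_two_id (μ := gaussianReal 0 1)).comp_measurePreserving
    measurePreserving_snd).comp_measurePreserving measurePreserving_snd

/-- A forward Gaussian of variance zero vanishes almost surely. -/
theorem ae_law_forward_eq_zero {n : ℕ} (n' : ℕ) {k : ℕ → Fin m → ℕ → Fin m → ℝ}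
    (k' : ℕ → Fin m → ℕ → Fin m → ℝ) (hk : (covMatrix n k).PosSemidef) {s : ℕ} {i : Fin m}
    (h0 : k s i s i = 0) : ∀ᵐ ω ∂law n n' k k', ω.1 s i = 0 := by
  have h1 : ∀ᵐ g ∂gaussianFamily n (fun p q => k p.1.val p.2 q.1.val q.2), g s i = 0 := by
    rw [gaussianFamily_eq, ae_map_iff (continuous_pad n).measurable.aemeasurable
      (measurableSet_eq_fun (by fun_prop) (by fun_prop))]
    by_cases hs : s < n
    · simp only [pad_of_lt _ hs]
      have hp := measurePreserving_eval_multivariateGaussian (μ := 0) hk (i := (⟨s, hs⟩, i))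
      rw [covMatrix_apply] at hp
      simp only [h0, Real.toNNReal_zero, gaussianReal_zero_var] at hp
      have := hp.quasiMeasurePreserving.ae (p := fun y => y = 0) 
        ((ae_dirac_iff (measurableSet_eq_fun measurable_id measurable_const)).2 rfl)
      exact this
    · simp [pad_of_le _ (not_lt.1 hs)]
  exact (measurePreserving_fst (ν := _)).quasiMeasurePreserving.ae h1

/-- Set to zero the forward coordinates at times `≥ n` and the backward ones at times `≥ n'`. -/
def trunc (n n' : ℕ) (ω : Noise m) : Noise m :=
  (fun s i => if s < n then ω.1 s i else 0, fun s i => if s < n' then ω.2.1 s i else 0, ω.2.2)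

theorem map_gaussianFamily {n₁ n : ℕ} (hn : n₁ ≤ n) {k : ℕ → Fin m → ℕ → Fin m → ℝ}
    (hk : (covMatrix n k).PosSemidef) :
    (gaussianFamily n (fun p q => k p.1.val p.2 q.1.val q.2)).map
      (fun g s i => if s < n₁ then g s i else 0) =
      gaussianFamily n₁ (fun p q => k p.1.val p.2 q.1.val q.2) := by
  have hm : Measurable fun (g : ℕ → Fin m → ℝ) s i => if s < n₁ then g s i else 0 := by
    refine measurable_pi_lambda _ fun s => measurable_pi_lambda _ fun i => ?_
    split_ifs <;> fun_prop
  rw [gaussianFamily_eq, gaussianFamily_eq, Measure.map_map hm (continuous_pad n).measurable]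
  have := map_submatrix_multivariateGaussian hk
    (fun p : Fin n₁ × Fin m => ((Fin.castLE hn p.1, p.2) : Fin n × Fin m))
  have h2 : (covMatrix n k).submatrix
      (fun p : Fin n₁ × Fin m => ((Fin.castLE hn p.1, p.2) : Fin n × Fin m))
      (fun p : Fin n₁ × Fin m => ((Fin.castLE hn p.1, p.2) : Fin n × Fin m)) =
      covMatrix n₁ k := rfl
  rw [← h2, ← this, Measure.map_map (continuous_pad n₁).measurable (by fun_prop)]
  congr 1
  ext g s i
  by_cases hs : s < n₁
  · simp [hs, pad_of_lt _ hs, pad_of_lt _ (hs.trans_le hn)]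
  · simp [hs, pad_of_le _ (not_lt.1 hs)]

theorem measurable_trunc (n n' : ℕ) : Measurable (trunc (m := m) n n') := by
  refine Measurable.prodMk ?_ (Measurable.prodMk ?_ (by fun_prop)) <;>
  · refine measurable_pi_lambda _ fun s => measurable_pi_lambda _ fun i => ?_
    split_ifs <;> fun_prop

/-- Consistency: the laws of the noise at an earlier stage are the marginals of the later ones. -/
theorem map_trunc_law {n₁ n n₁' n' : ℕ} (hn : n₁ ≤ n) (hn' : n₁' ≤ n')
    {k k' : ℕ → Fin m → ℕ → Fin m → ℝ} (hk : (covMatrix n k).PosSemidef)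
    (hk' : (covMatrix n' k').PosSemidef) :
    (law n n' k k').map (trunc n₁ n₁') = law n₁ n₁' k k' := by
  have hm (n₁ : ℕ) : Measurable fun (g : ℕ → Fin m → ℝ) s i => if s < n₁ then g s i else 0 := by
    refine measurable_pi_lambda _ fun s => measurable_pi_lambda _ fun i => ?_
    split_ifs <;> fun_prop
  rw [law, law, noiseLaw, noiseLaw, ← map_gaussianFamily hn hk, ← map_gaussianFamily hn' hk']
  nth_rw 2 [← Measure.map_id (μ := gaussianReal 0 1)]
  rw [Measure.map_prod_map _ _ (hm n₁') measurable_id,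
    Measure.map_prod_map _ _ (hm n₁) ((hm n₁').prodMap measurable_id)]
  rfl

theorem integral_law_eq {n₁ n n₁' n' : ℕ} (hn : n₁ ≤ n) (hn' : n₁' ≤ n')
    {k k' : ℕ → Fin m → ℕ → Fin m → ℝ} (hk : (covMatrix n k).PosSemidef)
    (hk' : (covMatrix n' k').PosSemidef) {F : Noise m → ℝ} (hF : Continuous F)
    (hFt : ∀ ω, F (trunc n₁ n₁' ω) = F ω) :
    ∫ ω, F ω ∂law n₁ n₁' k k' = ∫ ω, F ω ∂law n n' k k' := by
  rw [← map_trunc_law hn hn' hk hk', integral_map (measurable_trunc _ _).aemeasurable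
    hF.aestronglyMeasurable]
  simp only [hFt]

/-! ### Realizable values of a Gaussian family -/

open scoped Matrix in
theorem sqrtOp_sqrtOp {n : ℕ} {k : ℕ → Fin m → ℕ → Fin m → ℝ} (hk : (covMatrix n k).PosSemidef)
    (c : Fin n × Fin m → ℝ) (p : Fin n × Fin m) :
    sqrtOp n k (sqrtOp n k (WithLp.toLp 2 c)) p = (covMatrix n k *ᵥ c) p := by
  rw [sqrtOp, ← ContinuousLinearMap.comp_apply, ← ContinuousLinearMap.mul_def, ← map_mul,
    matrix_posSemidef_sqrt_mul_self hk, Matrix.ofLp_toEuclideanCLM]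

open scoped Matrix in
/-- If the quadratic form of `K` is anisotropic on vectors supported in `A`, then the vectors in the
range of `K` take arbitrary values on `A`. -/
theorem exists_mulVec_eq_on {ι : Type*} [Fintype ι] {K : Matrix ι ι ℝ} (A : ι → Prop)
    (hA : ∀ c : ι → ℝ, (∀ p, ¬ A p → c p = 0) → c ⬝ᵥ K *ᵥ c = 0 → c = 0) (z : ι → ℝ) :
    ∃ c : ι → ℝ, ∀ p, A p → (K *ᵥ c) p = z p := by
  classical
  let E : (ι → ℝ) →ₗ[ℝ] (ι → ℝ) :=
    { toFun := fun c p => if A p then c p else 0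
      map_add' := fun c d => by ext p; by_cases h : A p <;> simp [h]
      map_smul' := fun a c => by ext p; by_cases h : A p <;> simp [h] }
  have hE (c : ι → ℝ) (p : ι) : E c p = if A p then c p else 0 := rfl
  -- `T` is `K` compressed to the coordinates in `A`, and the identity on the others.
  let T : (ι → ℝ) →ₗ[ℝ] (ι → ℝ) := E ∘ₗ K.mulVecLin ∘ₗ E + (LinearMap.id - E)
  have hT (c : ι → ℝ) (p : ι) : T c p = if A p then (K *ᵥ E c) p else c p := by
    by_cases h : A p <;> simp [T, hE, h]
  have hinj : Function.Injective T := by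
    rw [← LinearMap.ker_eq_bot, LinearMap.ker_eq_bot']
    intro c hc
    have hp (p : ι) := (hT c p).symm.trans (congrFun hc p)
    have h1 : E c = 0 := by
      refine hA _ (fun p h => by simp [hE, h]) (Finset.sum_eq_zero fun p _ => ?_)
      by_cases h : A p
      · have := hp p
        rw [if_pos h] at this
        rw [this]; simp
      · simp [hE, h]
    ext p
    by_cases h : A p
    · simpa [hE, h] using congrFun h1 p
    · have := hp p
      rwa [if_neg h] at this
  obtain ⟨c, hc⟩ := (LinearMap.injective_iff_surjective.1 hinj) z
  refine ⟨E c, fun p h => ?_⟩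
  rw [← hc, hT, if_pos h]

open scoped Matrix in
/-- If the covariance is nondegenerate on the times in `A`, then the Gaussian variables at these
times can take arbitrary values. -/
theorem exists_sqrtOp_eq {n : ℕ} {k : ℕ → Fin m → ℕ → Fin m → ℝ}
    (hk : (covMatrix n k).PosSemidef) (A : ℕ → Prop)
    (hA : ∀ c : Fin n × Fin m → ℝ, (∀ p, ¬ A p.1 → c p = 0) →
      c ⬝ᵥ covMatrix n k *ᵥ c = 0 → c = 0) (z : ℕ → Fin m → ℝ) :
    ∃ x, ∀ s < n, A s → ∀ i, pad n (sqrtOp n k x) s i = z s i := by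
  obtain ⟨c, hc⟩ := exists_mulVec_eq_on (fun p : Fin n × Fin m => A p.1) hA
    (fun p => z p.1 p.2)
  refine ⟨sqrtOp n k (WithLp.toLp 2 c), fun s hs h i => ?_⟩
  rw [pad_of_lt _ hs, sqrtOp_sqrtOp hk, hc _ h]

section Gram

variable {Ω : Type*} [MeasurableSpace Ω] {ν : Measure Ω} {f : ℕ → Fin m → Ω → ℝ} {n : ℕ}
  {k : ℕ → Fin m → ℕ → Fin m → ℝ}

open scoped Matrix in
theorem dotProduct_covMatrix_mulVec (hf : ∀ s i, MemLp (f s i) 2 ν)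
    (hk : ∀ s < n, ∀ r < n, ∀ i j, k s i r j = ∫ ω, f s i ω * f r j ω ∂ν)
    (c : Fin n × Fin m → ℝ) :
    c ⬝ᵥ covMatrix n k *ᵥ c = ∫ ω, (∑ p : Fin n × Fin m, c p * f p.1 p.2 ω) ^ 2 ∂ν := by
  have h (ω : Ω) : (∑ p : Fin n × Fin m, c p * f p.1 p.2 ω) ^ 2 =
      ∑ p : Fin n × Fin m, ∑ q : Fin n × Fin m,
        c p * c q * (f p.1 p.2 ω * f q.1 q.2 ω) := by
    rw [sq, Finset.sum_mul_sum]
    exact Finset.sum_congr rfl fun p _ => Finset.sum_congr rfl fun q _ => by ring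
  have hi (p q : Fin n × Fin m) :
      Integrable (fun ω => c p * c q * (f p.1 p.2 ω * f q.1 q.2 ω)) ν :=
    ((hf _ _).integrable_mul (hf _ _)).const_mul _
  simp_rw [h]
  rw [integral_finsetSum _ fun p _ => integrable_finsetSum _ fun q _ => hi p q]
  refine Finset.sum_congr rfl fun p _ => ?_
  rw [integral_finsetSum _ fun q _ => hi p q, Matrix.mulVec, dotProduct, Finset.mul_sum]
  refine Finset.sum_congr rfl fun q _ => ?_
  rw [integral_const_mul, covMatrix_apply, hk _ p.1.2 _ q.1.2]
  ring

theorem covMatrix_posSemidef (hf : ∀ s i, MemLp (f s i) 2 ν)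
    (hk : ∀ s < n, ∀ r < n, ∀ i j, k s i r j = ∫ ω, f s i ω * f r j ω ∂ν) :
    (covMatrix n k).PosSemidef := by
  refine Matrix.PosSemidef.of_dotProduct_mulVec_nonneg ?_ fun c => ?_
  · ext p q
    simp only [Matrix.conjTranspose_apply, star_trivial, covMatrix_apply]
    rw [hk _ q.1.2 _ p.1.2, hk _ p.1.2 _ q.1.2]
    simp_rw [mul_comm]
  · rw [star_trivial, dotProduct_covMatrix_mulVec hf hk]
    exact integral_nonneg fun ω => sq_nonneg _

open scoped Matrix in
/-- The covariance is nondegenerate on the times in `A` if the variables at these times are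
linearly independent. -/
theorem covMatrix_nondegenerate (hf : ∀ s i, MemLp (f s i) 2 ν)
    (hk : ∀ s < n, ∀ r < n, ∀ i j, k s i r j = ∫ ω, f s i ω * f r j ω ∂ν) {A : ℕ → Prop}
    (hA : ∀ c : ℕ → Fin m → ℝ, (∀ s, ¬ A s → c s = 0) →
      (∀ᵐ ω ∂ν, ∑ s ∈ Finset.range n, ∑ i, c s i * f s i ω = 0) → ∀ s < n, c s = 0)
    (c : Fin n × Fin m → ℝ) (hc : ∀ p, ¬ A p.1 → c p = 0)
    (h0 : c ⬝ᵥ covMatrix n k *ᵥ c = 0) : c = 0 := by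
  classical
  rw [dotProduct_covMatrix_mulVec hf hk] at h0
  have hm : MemLp (fun ω => ∑ p : Fin n × Fin m, c p * f p.1 p.2 ω) 2 ν :=
    memLp_finsetSum _ fun p _ => (hf _ _).const_mul _
  have h1 := (integral_eq_zero_iff_of_nonneg (fun ω => sq_nonneg _) hm.integrable_sq).1 h0
  have h2 := hA (fun s i => if hs : s < n then c (⟨s, hs⟩, i) else 0) (fun s hs => by
    ext i
    by_cases h : s < n
    · simpa [h] using hc (⟨s, h⟩, i) hs
    · simp [h]) (by
    filter_upwards [h1] with ω hω
    have hω' := pow_eq_zero_iff two_ne_zero |>.1 hω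
    rw [← hω', Fintype.sum_prod_type, Finset.sum_range]
    simp)
  ext p
  simpa using congrFun (h2 p.1 p.1.2) p.2

end Gram

/-! ### The recursion with its scalars collected -/

variable {d : ℕ} (S : TrainingSetup d m)

/-- The scalar multiplying `Z^{dh_s^l(ξ_j)}` in `Z^{δh_{t+1}^l(ξ_i)}`. -/
def driftCoef (t l : ℕ) (i : Fin m) (s : ℕ) (j : Fin m) : ℝ :=
  match l with
  | 0 => 0
  | 1 => if s = t then - (S.η * S.χ t j * inner ℝ (S.input j) (S.input i)) else 0
  | k + 2 =>
    (∫ ω, dBackward s j (fun ω' => S.Zδx (t + 1) (k + 1) i ω') ω ∂S.lawForward (t + 1) (k + 1))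
    - S.η * (S.χ s j * if s = t then
          ∫ ω, S.Zx t (k + 1) j ω * S.Zx (t + 1) (k + 1) i ω ∂S.lawForward (t + 1) (k + 1)
        else
          ∫ ω, S.Zx s (k + 1) j ω * S.Zδx (t + 1) (k + 1) i ω ∂S.lawForward (t + 1) (k + 1))

theorem Zh_zero (l : ℕ) (i : Fin m) (ω : Noise m) : S.Zh 0 l i ω = ω.1 0 i := by
  rw [Zh]

theorem Zh_succ (t l : ℕ) (i : Fin m) (ω : Noise m) :
    S.Zh (t + 1) l i ω = S.Zh t l i ω + (if 2 ≤ l then ω.1 (t + 1) i else 0) +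
      ∑ s ∈ Finset.range (t + 1), ∑ j, S.driftCoef t l i s j * S.Zdh s l j ω := by
  match l with
  | 0 => rw [Zh]; simp [driftCoef]
  | 1 =>
    have h1 : ∑ s ∈ Finset.range t, ∑ j, S.driftCoef t 1 i s j * S.Zdh s 1 j ω = 0 :=
      Finset.sum_eq_zero fun s hs => by simp [driftCoef, (Finset.mem_range.1 hs).ne]
    rw [Zh, Finset.sum_range_succ, h1]
    simp [driftCoef]
  | k + 2 =>
    rw [Zh]
    simp only [Nat.le_add_left, if_true, driftCoef, sub_mul, Finset.sum_sub_distrib]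
    have h1 : ∑ s ∈ Finset.range (t + 1), ∑ j,
        (∫ ω, dBackward s j (fun ω' => S.Zδx (t + 1) (k + 1) i ω') ω
          ∂S.lawForward (t + 1) (k + 1)) * S.Zdh s (k + 2) j ω =
        ∑ s : Fin (t + 1), ∑ j, S.Zdh s.val (k + 2) j ω *
          ∫ ω, dBackward s.val j (fun ω' => S.Zδx (t + 1) (k + 1) i ω') ω
          ∂S.lawForward (t + 1) (k + 1) := by
      rw [Finset.sum_range]
      exact Finset.sum_congr rfl fun s _ => Finset.sum_congr rfl fun j _ => mul_comm _ _
    have h2 : ∑ j, S.η * (S.χ t j * if t = t then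
          ∫ ω, S.Zx t (k + 1) j ω * S.Zx (t + 1) (k + 1) i ω ∂S.lawForward (t + 1) (k + 1)
        else ∫ ω, S.Zx t (k + 1) j ω * S.Zδx (t + 1) (k + 1) i ω
          ∂S.lawForward (t + 1) (k + 1)) * S.Zdh t (k + 2) j ω =
        S.η * ∑ j, S.χ t j * S.Zdh t (k + 2) j ω *
          ∫ ω, S.Zx t (k + 1) j ω * S.Zx (t + 1) (k + 1) i ω ∂S.lawForward (t + 1) (k + 1) := by
      rw [Finset.mul_sum]
      exact Finset.sum_congr rfl fun j _ => by rw [if_pos rfl]; ring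
    have h3 : ∑ s ∈ Finset.range t, ∑ j, S.η * (S.χ s j * if s = t then
          ∫ ω, S.Zx t (k + 1) j ω * S.Zx (t + 1) (k + 1) i ω ∂S.lawForward (t + 1) (k + 1)
        else ∫ ω, S.Zx s (k + 1) j ω * S.Zδx (t + 1) (k + 1) i ω
          ∂S.lawForward (t + 1) (k + 1)) * S.Zdh s (k + 2) j ω =
        S.η * ∑ s : Fin t, ∑ j, S.χ s.val j * S.Zdh s.val (k + 2) j ω *
          ∫ ω, S.Zx s.val (k + 1) j ω * S.Zδx (t + 1) (k + 1) i ω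
            ∂S.lawForward (t + 1) (k + 1) := by
      rw [Finset.mul_sum, Finset.sum_range]
      refine Finset.sum_congr rfl fun s _ => ?_
      rw [Finset.mul_sum]
      exact Finset.sum_congr rfl fun j _ => by rw [if_neg s.2.ne]; ring
    rw [h1, Finset.sum_range_succ _ t, h2, h3]
    ring

theorem Zx_eq (t l : ℕ) (i : Fin m) (ω : Noise m) : S.Zx t l i ω = S.φ (S.Zh t l i ω) := by
  rw [Zx]

theorem Zδx_zero (l : ℕ) (i : Fin m) (ω : Noise m) : S.Zδx 0 l i ω = S.φ (S.Zh 0 l i ω) := by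
  rw [Zδx]

theorem Zδx_succ (t l : ℕ) (i : Fin m) (ω : Noise m) :
    S.Zδx (t + 1) l i ω = S.φ (S.Zh (t + 1) l i ω) - S.φ (S.Zh t l i ω) := by
  rw [Zδx]

theorem ZŴ_zero (ω : Noise m) : S.ZŴ 0 ω = ω.2.2 := by rw [ZŴ]

theorem ZŴ_succ (t : ℕ) (ω : Noise m) :
    S.ZŴ (t + 1) ω = S.ZŴ t ω - S.η * ∑ i, S.χ t i * S.φ (S.Zh t S.depth i ω) := by
  rw [ZŴ]; simp only [Zx_eq]

theorem Zdh_eq (t l : ℕ) (i : Fin m) (ω : Noise m) :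
    S.Zdh t l i ω = S.Zdx t l i ω * deriv S.φ (S.Zh t l i ω) := by
  rw [Zdh]

theorem Zdx_of_le {l : ℕ} (hl : S.depth ≤ l) (t : ℕ) (i : Fin m) (ω : Noise m) :
    S.Zdx t l i ω = S.ZŴ t ω := by
  rw [Zdx, if_neg (not_lt.2 hl)]

/-- Below the last layer, `Z^{dx_t^l}` is the fresh backward Gaussian plus a linear combination of
the post-activations up to time `t`. -/
theorem exists_Zdx_eq {l : ℕ} (hl : l < S.depth) (t : ℕ) (i : Fin m) :
    ∃ b b' : ℕ → Fin m → ℝ, ∀ ω, S.Zdx t l i ω = ω.2.1 t i +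
      (∑ s ∈ Finset.range (t + 1), ∑ j, b s j * S.Zδx s l j ω) +
      ∑ s ∈ Finset.range t, ∑ j, b' s j * S.φ (S.Zh s l j ω) := by
  refine ⟨fun s j => ∫ ω', dForward s j (fun ω'' => S.Zdh t (l + 1) i ω'') ω'
      ∂S.lawBackward t (l + 1),
    fun s j => - (S.η * S.χ s j *
      ∫ ω', S.Zdh s (l + 1) j ω' * S.Zdh t (l + 1) i ω' ∂S.lawBackward t (l + 1)),
    fun ω => ?_⟩
  rw [Zdx, if_pos hl, Finset.sum_range, Finset.sum_range]
  simp only [neg_mul, Finset.sum_neg_distrib, ← sub_eq_add_neg, Finset.mul_sum, Zx_eq]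
  refine congrArg₂ _ (congrArg₂ _ rfl ?_) ?_
  · exact Finset.sum_congr rfl fun s _ => Finset.sum_congr rfl fun j _ => mul_comm _ _
  · refine Finset.sum_congr rfl fun s _ => Finset.sum_congr rfl fun j _ => ?_
    ring

theorem lawForward_eq (t l : ℕ) :
    S.lawForward t l = law (t + 1) t (S.covForward l) (S.covBackward l) := by
  rw [lawForward]; rfl

theorem lawBackward_eq (t l : ℕ) :
    S.lawBackward t l = law (t + 1) (t + 1) (S.covForward l) (S.covBackward l) := by
  rw [lawBackward]; rfl

/-! ### Regularity of the variables -/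

/-- A function of the noise that is continuous and square integrable under all Gaussian laws. -/
def Regular (F : Noise m → ℝ) : Prop :=
  Continuous F ∧ ∀ n n' k k', MemLp F 2 (law n n' k k')

namespace Regular

variable {F G : Noise m → ℝ}

theorem add (hF : Regular F) (hG : Regular G) : Regular fun ω => F ω + G ω :=
  ⟨hF.1.add hG.1, fun n n' k k' => (hF.2 n n' k k').add (hG.2 n n' k k')⟩

theorem sub (hF : Regular F) (hG : Regular G) : Regular fun ω => F ω - G ω :=
  ⟨hF.1.sub hG.1, fun n n' k k' => (hF.2 n n' k k').sub (hG.2 n n' k k')⟩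

theorem const_mul (c : ℝ) (hF : Regular F) : Regular fun ω => c * F ω :=
  ⟨hF.1.const_mul c, fun n n' k k' => (hF.2 n n' k k').const_mul c⟩

theorem sum {ι : Type*} (s : Finset ι) {F : ι → Noise m → ℝ} (hF : ∀ i ∈ s, Regular (F i)) :
    Regular fun ω => ∑ i ∈ s, F i ω :=
  ⟨continuous_finsetSum s fun i hi => (hF i hi).1,
    fun n n' k k' => memLp_finsetSum s fun i hi => (hF i hi).2 n n' k k'⟩

theorem zero : Regular fun _ : Noise m => 0 :=
  ⟨continuous_const, fun _ _ _ _ => memLp_const _⟩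

theorem activation {φ : ℝ → ℝ} (hφ : ActivationAssumption φ) (hF : Regular F) :
    Regular fun ω => φ (F ω) := by
  obtain ⟨C, hC⟩ := hφ.bounded_deriv
  have hd : Differentiable ℝ φ := hφ.contDiff.differentiable two_ne_zero
  have hc : Continuous fun ω => φ (F ω) := hφ.contDiff.continuous.comp hF.1
  have hb (x : ℝ) : ‖φ x‖ ≤ ‖φ 0‖ + C * ‖x‖ := by
    have h := Convex.norm_image_sub_le_of_norm_deriv_le (f := φ) (s := Set.univ) (x := 0) (y := x)
      (C := C) (fun y _ => hd y) (fun y _ => (Real.norm_eq_abs _).trans_le (hC y))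
      convex_univ (Set.mem_univ _) (Set.mem_univ _)
    rw [sub_zero] at h
    linarith [norm_sub_norm_le (φ x) (φ 0)]
  refine ⟨hc, fun n n' k k' => ?_⟩
  have hg : MemLp (fun ω => ‖φ 0‖ + C * ‖F ω‖) 2 (law n n' k k') :=
    MemLp.add (f := fun _ => ‖φ 0‖) (g := fun ω => C * ‖F ω‖) (memLp_const _)
      (MemLp.const_mul (hF.2 n n' k k').norm C)
  exact hg.mono' hc.aestronglyMeasurable
    (Filter.Eventually.of_forall fun ω => hb (F ω))

theorem mul_deriv {φ : ℝ → ℝ} (hφ : ActivationAssumption φ) (hF : Regular F)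
    (hG : Continuous G) : Regular fun ω => F ω * deriv φ (G ω) := by
  obtain ⟨C, hC⟩ := hφ.bounded_deriv
  have hc : Continuous fun ω => F ω * deriv φ (G ω) :=
    hF.1.mul ((hφ.contDiff.continuous_deriv one_le_two).comp hG)
  refine ⟨hc, fun n n' k k' => ((hF.2 n n' k k').norm.const_mul C).mono' hc.aestronglyMeasurable
    (Filter.Eventually.of_forall fun ω => ?_)⟩
  rw [norm_mul, mul_comm]
  exact mul_le_mul_of_nonneg_right (hC _) (norm_nonneg _)

theorem forward (s : ℕ) (i : Fin m) : Regular fun ω : Noise m => ω.1 s i :=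
  ⟨by fun_prop, fun n n' k k' => memLp_law_forward n n' k k' s i⟩

theorem backward (s : ℕ) (i : Fin m) : Regular fun ω : Noise m => ω.2.1 s i :=
  ⟨by fun_prop, fun n n' k k' => memLp_law_backward n n' k k' s i⟩

theorem last : Regular fun ω : Noise m => ω.2.2 :=
  ⟨by fun_prop, fun n n' k k' => memLp_law_output n n' k k'⟩

end Regular

section

variable {S} (hφ : ActivationAssumption S.φ)
include hφ

theorem regular_Zh_ZŴ_Zdx (t : ℕ) : (∀ l i, Regular (S.Zh t l i)) ∧ Regular (S.ZŴ t) ∧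
    ∀ l i, Regular (S.Zdx t l i) := by
  induction t using Nat.strong_induction_on with
  | _ t ih =>
  have hh : ∀ l i, Regular (S.Zh t l i) := by
    intro l i
    cases t with
    | zero => simpa only [funext (S.Zh_zero l i)] using Regular.forward 0 i
    | succ t =>
      rw [funext (S.Zh_succ t l i)]
      refine (((ih t t.lt_succ_self).1 l i).add ?_).add ?_
      · split_ifs
        exacts [Regular.forward _ _, Regular.zero]
      · refine Regular.sum _ fun s hs => Regular.sum _ fun j _ => Regular.const_mul _ ?_
        rw [funext (S.Zdh_eq s l j)]
        have := ih s (Finset.mem_range.1 hs)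
        exact (this.2.2 l j).mul_deriv hφ (this.1 l j).1
  have hh' : ∀ s ≤ t, ∀ l i, Regular (S.Zh s l i) := fun s hs l i => by
    rcases hs.lt_or_eq with h | rfl
    exacts [(ih s h).1 l i, hh l i]
  have hW : Regular (S.ZŴ t) := by
    cases t with
    | zero => simpa only [funext S.ZŴ_zero] using Regular.last
    | succ t =>
      rw [funext (S.ZŴ_succ t)]
      exact (ih t t.lt_succ_self).2.1.sub (Regular.const_mul _ (Regular.sum _ fun i _ =>
        Regular.const_mul _ ((hh' t t.le_succ _ i).activation hφ)))
  refine ⟨hh, hW, fun l i => ?_⟩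
  rcases lt_or_ge l S.depth with hl | hl
  · obtain ⟨b, b', hb⟩ := S.exists_Zdx_eq hl t i
    rw [funext hb]
    refine ((Regular.backward t i).add ?_).add ?_
    · refine Regular.sum _ fun s hs => Regular.sum _ fun j _ => Regular.const_mul _ ?_
      have hs' := Nat.lt_succ_iff.1 (Finset.mem_range.1 hs)
      cases s with
      | zero =>
        rw [funext (S.Zδx_zero l j)]
        exact (hh' 0 hs' l j).activation hφ
      | succ s =>
        rw [funext (S.Zδx_succ s l j)]
        exact ((hh' _ hs' l j).activation hφ).sub
          ((hh' s (s.le_succ.trans hs') l j).activation hφ)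
    · exact Regular.sum _ fun s hs => Regular.sum _ fun j _ => Regular.const_mul _
        ((hh' s (Finset.mem_range.1 hs).le l j).activation hφ)
  · rw [funext (S.Zdx_of_le hl t i)]
    exact hW

theorem regular_Zh (t l : ℕ) (i : Fin m) : Regular (S.Zh t l i) := (regular_Zh_ZŴ_Zdx hφ t).1 l i

theorem regular_Zdx (t l : ℕ) (i : Fin m) : Regular (S.Zdx t l i) :=
  (regular_Zh_ZŴ_Zdx hφ t).2.2 l i

theorem regular_Zdh (t l : ℕ) (i : Fin m) : Regular (S.Zdh t l i) := by
  rw [funext (S.Zdh_eq t l i)]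
  exact (regular_Zdx hφ t l i).mul_deriv hφ (regular_Zh hφ t l i).1

theorem regular_Zδx (t l : ℕ) (i : Fin m) : Regular (S.Zδx t l i) := by
  cases t with
  | zero => rw [funext (S.Zδx_zero l i)]; exact (regular_Zh hφ 0 l i).activation hφ
  | succ t =>
    rw [funext (S.Zδx_succ t l i)]
    exact ((regular_Zh hφ _ l i).activation hφ).sub ((regular_Zh hφ _ l i).activation hφ)

end

/-! ### Which Gaussian variables matter -/

/-- The step from time `t` to `t + 1` is active if some error signal at time `t` is nonzero. -/
def Active (t : ℕ) : Prop := ∃ i, S.χ t i ≠ 0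

/-- Times at which the features are new: the initial time and those that follow an active step. -/
def Fresh (t : ℕ) : Prop := t = 0 ∨ ∃ s, t = s + 1 ∧ S.Active s

/-- Agreement of two points in the coordinates that the variables of layer `l` may depend on:
forward Gaussians at times `< n`, backward Gaussians at active times `< n'` (present below the
last layer only) and `Z^{Ŵ₀^{L+1}}`. -/
def Agree (l n n' : ℕ) (ω ω' : Noise m) : Prop :=
  (∀ s < n, ω.1 s = ω'.1 s) ∧
    (l < S.depth → ∀ s < n', S.Active s → ω.2.1 s = ω'.2.1 s) ∧ ω.2.2 = ω'.2.2

variable {S}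

theorem Agree.mono {l n n' p p' : ℕ} {ω ω' : Noise m} (h : S.Agree l p p' ω ω') (hn : n ≤ p)
    (hn' : n' ≤ p') : S.Agree l n n' ω ω' :=
  ⟨fun s hs => h.1 s (hs.trans_le hn), fun hl s hs => h.2.1 hl s (hs.trans_le hn'), h.2.2⟩

theorem Agree.depth {l n n' : ℕ} {ω ω' : Noise m} (h : S.Agree l n n' ω ω') :
    S.Agree S.depth n n' ω ω' :=
  ⟨h.1, fun hl => absurd hl (lt_irrefl _), h.2.2⟩

theorem χ_eq_zero_of_not_active {s : ℕ} (hs : ¬ S.Active s) (j : Fin m) : S.χ s j = 0 := by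
  by_contra h
  exact hs ⟨j, h⟩

theorem agree_trunc (l n n' : ℕ) (ω : Noise m) : S.Agree l n n' (trunc n n' ω) ω :=
  ⟨fun s hs => by ext i; simp [trunc, hs], fun _ s hs _ => by ext i; simp [trunc, hs], rfl⟩

theorem Zδx_congr {t l : ℕ} {ω ω' : Noise m}
    (h : ∀ s ≤ t, ∀ i, S.Zh s l i ω = S.Zh s l i ω') (i : Fin m) :
    S.Zδx t l i ω = S.Zδx t l i ω' := by
  cases t with
  | zero => rw [Zδx_zero, Zδx_zero, h 0 le_rfl]
  | succ t => rw [Zδx_succ, Zδx_succ, h _ le_rfl, h t t.le_succ]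

/-- If the post-activation features at time `t + 1` of the layer below do not depend on the
backward Gaussians at inactive times, the corresponding drift coefficients vanish. -/
theorem driftCoef_eq_zero_of_not_active {t l : ℕ}
    (hZ : ∀ k, l = k + 2 → ∀ i ω ω', S.Agree (k + 1) (t + 2) (t + 1) ω ω' →
      S.Zδx (t + 1) (k + 1) i ω = S.Zδx (t + 1) (k + 1) i ω')
    {s : ℕ} (hs : ¬ S.Active s) (i j : Fin m) : S.driftCoef t l i s j = 0 := by
  match l with
  | 0 => rfl
  | 1 =>
    by_cases h : s = t
    · subst h; simp [driftCoef, χ_eq_zero_of_not_active hs]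
    · simp [driftCoef, h]
  | k + 2 =>
    have h1 (ω : Noise m) : dBackward s j (fun ω' => S.Zδx (t + 1) (k + 1) i ω') ω = 0 := by
      rw [dBackward, lineDeriv]
      have : (fun r : ℝ => S.Zδx (t + 1) (k + 1) i
          (ω + r • ((0, Pi.single s (Pi.single j 1), 0) : Noise m))) =
          fun _ => S.Zδx (t + 1) (k + 1) i ω := by
        ext r
        refine hZ k rfl i _ _ ⟨fun s _ => by simp, fun _ s' _ hs' => ?_, by simp⟩
        have : s' ≠ s := fun h => hs (h ▸ hs')
        simp [this]
      rw [this, deriv_const]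
    simp [driftCoef, h1, χ_eq_zero_of_not_active hs]

/-- The variables depend on the relevant coordinates only. That inactive backward Gaussians are
irrelevant is the point: the drift coefficients of inactive times contain derivatives of variables
of the layer below with respect to its own inactive Gaussians, whence the induction over layers. -/
theorem Zh_ZŴ_Zdx_congr (t : ℕ) :
    (∀ l i ω ω', S.Agree l (t + 1) t ω ω' → S.Zh t l i ω = S.Zh t l i ω') ∧
    (∀ ω ω', S.Agree S.depth t t ω ω' → S.ZŴ t ω = S.ZŴ t ω') ∧
    ∀ l i ω ω', S.Agree l (t + 1) t ω ω' → (l < S.depth → ω.2.1 t = ω'.2.1 t) →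
      S.Zdx t l i ω = S.Zdx t l i ω' := by
  induction t using Nat.strong_induction_on with
  | _ t ih =>
  have hh : ∀ l i ω ω', S.Agree l (t + 1) t ω ω' → S.Zh t l i ω = S.Zh t l i ω' := by
    intro l
    induction l using Nat.strong_induction_on with
    | _ l ihl =>
    intro i ω ω' h
    cases t with
    | zero => rw [Zh_zero, Zh_zero, h.1 0 zero_lt_one]
    | succ t =>
      rw [Zh_succ, Zh_succ, (ih t t.lt_succ_self).1 l i ω ω' (h.mono (by omega) (by omega)),
        h.1 (t + 1) (by omega)]
      congr 1
      refine Finset.sum_congr rfl fun s hs => Finset.sum_congr rfl fun j _ => ?_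
      have hs' := Finset.mem_range.1 hs
      by_cases ha : S.Active s
      · rw [Zdh_eq, Zdh_eq, (ih s hs').1 l j ω ω' (h.mono (by omega) (by omega)),
          (ih s hs').2.2 l j ω ω' (h.mono (by omega) (by omega))
            fun hl => h.2.1 hl s hs' ha]
      · rw [driftCoef_eq_zero_of_not_active _ ha, zero_mul, zero_mul]
        intro k hk i ω ω' hag
        refine Zδx_congr (fun r hr i => ?_) i
        rcases hr.lt_or_eq with h' | rfl
        · exact (ih r h').1 _ i ω ω' (hag.mono (by omega) (by omega))
        · exact ihl (k + 1) (by omega) i ω ω' (hag.mono (by omega) (by omega))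
  have hh' : ∀ s ≤ t, ∀ l i ω ω', S.Agree l (s + 1) s ω ω' → S.Zh s l i ω = S.Zh s l i ω' := by
    intro s hs l i
    rcases hs.lt_or_eq with h | rfl
    exacts [(ih s h).1 l i, hh l i]
  have hW : ∀ ω ω', S.Agree S.depth t t ω ω' → S.ZŴ t ω = S.ZŴ t ω' := by
    intro ω ω' h
    cases t with
    | zero => rw [ZŴ_zero, ZŴ_zero, h.2.2]
    | succ t =>
      rw [ZŴ_succ, ZŴ_succ, (ih t t.lt_succ_self).2.1 ω ω' (h.mono (by omega) (by omega))]
      simp only [fun i => (ih t t.lt_succ_self).1 S.depth i ω ω' (h.mono (by omega) (by omega))]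
  refine ⟨hh, hW, fun l i ω ω' h hb => ?_⟩
  have hZ : ∀ s ≤ t, ∀ j, S.Zh s l j ω = S.Zh s l j ω' := fun s hs j =>
    hh' s hs l j ω ω' (h.mono (by omega) (by omega))
  rcases lt_or_ge l S.depth with hl | hl
  · obtain ⟨b, b', hb'⟩ := S.exists_Zdx_eq hl t i
    rw [hb', hb', hb hl]
    congr 1
    · congr 1
      refine Finset.sum_congr rfl fun s hs => Finset.sum_congr rfl fun j _ => ?_
      rw [Zδx_congr fun r hr => hZ r (hr.trans (Nat.lt_succ_iff.1 (Finset.mem_range.1 hs)))]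
    · refine Finset.sum_congr rfl fun s hs => Finset.sum_congr rfl fun j _ => ?_
      rw [hZ s (Finset.mem_range.1 hs).le]
  · rw [Zdx_of_le S hl, Zdx_of_le S hl, hW ω ω' (h.depth.mono (by omega) (by omega))]

theorem Zh_congr {t l : ℕ} {ω ω' : Noise m} (h : S.Agree l (t + 1) t ω ω') (i : Fin m) :
    S.Zh t l i ω = S.Zh t l i ω' := (Zh_ZŴ_Zdx_congr t).1 l i ω ω' h

theorem ZŴ_congr {t : ℕ} {ω ω' : Noise m} (h : S.Agree S.depth t t ω ω') :
    S.ZŴ t ω = S.ZŴ t ω' := (Zh_ZŴ_Zdx_congr t).2.1 ω ω' h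

theorem Zdx_congr {t l : ℕ} {ω ω' : Noise m} (h : S.Agree l (t + 1) t ω ω')
    (hb : l < S.depth → ω.2.1 t = ω'.2.1 t) (i : Fin m) : S.Zdx t l i ω = S.Zdx t l i ω' :=
  (Zh_ZŴ_Zdx_congr t).2.2 l i ω ω' h hb

theorem Zdh_congr {t l : ℕ} {ω ω' : Noise m} (h : S.Agree l (t + 1) t ω ω')
    (hb : l < S.depth → ω.2.1 t = ω'.2.1 t) (i : Fin m) : S.Zdh t l i ω = S.Zdh t l i ω' := by
  rw [Zdh_eq, Zdh_eq, Zh_congr h, Zdx_congr h hb]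

theorem Zδx_congr_of_agree {t l : ℕ} {ω ω' : Noise m} (h : S.Agree l (t + 1) t ω ω')
    (i : Fin m) : S.Zδx t l i ω = S.Zδx t l i ω' :=
  Zδx_congr (fun _ hs i => Zh_congr (h.mono (by omega) (by omega)) i) i

theorem driftCoef_of_not_active {s : ℕ} (hs : ¬ S.Active s) (t l : ℕ) (i j : Fin m) :
    S.driftCoef t l i s j = 0 :=
  driftCoef_eq_zero_of_not_active (fun _ _ _ _ _ h => Zδx_congr_of_agree h _) hs i j

/-! ### The covariances are Gram matrices -/

/-- `covForward` is defined by integrals under laws that vary with the times; by consistency of the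
Gaussian laws they can all be computed under one law. -/
theorem covForward_eq_integral (hφ : ActivationAssumption S.φ) {k n n' : ℕ} (hn : n ≤ n' + 1)
    (hF : (covMatrix n (S.covForward (k + 1))).PosSemidef)
    (hB : (covMatrix n' (S.covBackward (k + 1))).PosSemidef) :
    ∀ s < n, ∀ r < n, ∀ i j, S.covForward (k + 2) s i r j =
      ∫ ω, S.Zδx s (k + 1) i ω * S.Zδx r (k + 1) j ω
        ∂law n n' (S.covForward (k + 1)) (S.covBackward (k + 1)) := by
  intro s hs r hr i j
  have hag (ω : Noise m) := S.agree_trunc (k + 1) (max s r + 1) (max s r) ω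
  rw [covForward, lawForward_eq]
  refine integral_law_eq (by omega) (by omega) hF hB
    ((regular_Zδx hφ _ _ _).1.mul (regular_Zδx hφ _ _ _).1) fun ω => ?_
  rw [Zδx_congr_of_agree ((hag ω).mono (by omega) (by omega)),
    Zδx_congr_of_agree ((hag ω).mono (by omega) (by omega))]

theorem covBackward_eq_integral (hφ : ActivationAssumption S.φ) {l n n' : ℕ} (hn : n' ≤ n)
    (hl : l < S.depth) (hF : (covMatrix n (S.covForward (l + 1))).PosSemidef)
    (hB : (covMatrix n' (S.covBackward (l + 1))).PosSemidef) :
    ∀ s < n', ∀ r < n', ∀ i j, S.covBackward l s i r j =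
      ∫ ω, S.Zdh s (l + 1) i ω * S.Zdh r (l + 1) j ω
        ∂law n n' (S.covForward (l + 1)) (S.covBackward (l + 1)) := by
  intro s hs r hr i j
  have hag (ω : Noise m) := S.agree_trunc (l + 1) (max s r + 1) (max s r + 1) ω
  rw [covBackward, if_pos hl, lawBackward_eq]
  refine integral_law_eq (by omega) (by omega) hF hB
    ((regular_Zdh hφ _ _ _).1.mul (regular_Zdh hφ _ _ _).1) fun ω => ?_
  have hb (p : ℕ) (hp : p < max s r + 1) :
      (trunc (max s r + 1) (max s r + 1) ω).2.1 p = ω.2.1 p := by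
    ext i; exact if_pos hp
  rw [Zdh_congr ((hag ω).mono (by omega) (by omega)) fun _ => hb s (by omega),
    Zdh_congr ((hag ω).mono (by omega) (by omega)) fun _ => hb r (by omega)]

theorem covMatrix_covForward_one_posSemidef (n : ℕ) :
    (covMatrix n (S.covForward 1)).PosSemidef := by
  have : covMatrix n (S.covForward 1) = Matrix.gram ℝ
      (fun p : Fin n × Fin m => if p.1.val = 0 then S.input p.2 else 0) := by
    ext p q
    rw [covMatrix_apply, covForward, Matrix.gram_apply]
    by_cases hp : p.1.val = 0 <;> by_cases hq : q.1.val = 0 <;> simp [hp, hq]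
  rw [this]
  exact Matrix.posSemidef_gram ..

theorem covMatrix_forward_posSemidef_step (hφ : ActivationAssumption S.φ) {n n' : ℕ}
    (hn : n ≤ n' + 1) (hB : ∀ l, (covMatrix n' (S.covBackward l)).PosSemidef) (l : ℕ) :
    (covMatrix n (S.covForward l)).PosSemidef := by
  induction l with
  | zero =>
    have : covMatrix n (S.covForward 0) = 0 := by
      ext p q; rw [covMatrix_apply, covForward]; rfl
    rw [this]; exact Matrix.PosSemidef.zero
  | succ l ih =>
    cases l with
    | zero => exact covMatrix_covForward_one_posSemidef n
    | succ k =>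
      exact covMatrix_posSemidef (fun s i => (regular_Zδx hφ s (k + 1) i).2 _ _ _ _)
        (covForward_eq_integral hφ hn ih (hB _))

theorem covMatrix_backward_posSemidef_step (hφ : ActivationAssumption S.φ) {n n' : ℕ}
    (hn : n' ≤ n) (hF : ∀ l, (covMatrix n (S.covForward l)).PosSemidef) (q l : ℕ)
    (hq : S.depth ≤ l + q) : (covMatrix n' (S.covBackward l)).PosSemidef := by
  induction q generalizing l with
  | zero =>
    have : covMatrix n' (S.covBackward l) = 0 := by
      ext p q; rw [covMatrix_apply, covBackward, if_neg (by omega)]; rfl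
    rw [this]; exact Matrix.PosSemidef.zero
  | succ q ih =>
    by_cases hl : l < S.depth
    · exact covMatrix_posSemidef (fun s i => (regular_Zdh hφ s (l + 1) i).2 _ _ _ _)
        (covBackward_eq_integral hφ hn hl (hF _) (ih (l + 1) (by omega)))
    · exact ih l (by omega)

theorem covMatrix_forward_and_backward_posSemidef (hφ : ActivationAssumption S.φ) (n : ℕ) :
    (∀ l, (covMatrix n (S.covForward l)).PosSemidef) ∧
      ∀ l, (covMatrix n (S.covBackward l)).PosSemidef := by
  induction n with
  | zero =>
    have hz (k : ℕ → Fin m → ℕ → Fin m → ℝ) : (covMatrix 0 k).PosSemidef := by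
      have : covMatrix 0 k = 0 := by ext p; exact p.1.elim0
      rw [this]; exact Matrix.PosSemidef.zero
    exact ⟨fun _ => hz _, fun _ => hz _⟩
  | succ n ih =>
    have hF := covMatrix_forward_posSemidef_step hφ (le_refl (n + 1)) ih.2
    exact ⟨hF, fun l => covMatrix_backward_posSemidef_step hφ le_rfl hF S.depth l (by omega)⟩

theorem covMatrix_forward_posSemidef (hφ : ActivationAssumption S.φ) (n l : ℕ) :
    (covMatrix n (S.covForward l)).PosSemidef :=
  (covMatrix_forward_and_backward_posSemidef hφ n).1 l

theorem covMatrix_backward_posSemidef (hφ : ActivationAssumption S.φ) (n l : ℕ) :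
    (covMatrix n (S.covBackward l)).PosSemidef :=
  (covMatrix_forward_and_backward_posSemidef hφ n).2 l

/-! ### Idle steps -/

theorem covForward_diag_eq_zero {k t : ℕ} {i : Fin m}
    (h : ∀ᵐ ω ∂S.lawForward t (k + 1), S.Zδx t (k + 1) i ω = 0) :
    S.covForward (k + 2) t i t i = 0 := by
  rw [covForward, max_self]
  exact integral_eq_zero_of_ae (h.mono fun ω hω => by simp [hω])

/-- A step at which all error signals vanish moves no feature: the drift vanishes identically, and
the fresh forward Gaussians have variance zero. -/
theorem idle_step (hφ : ActivationAssumption S.φ) {t : ℕ} (ht : ¬ S.Active t) (l : ℕ) :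
    (∀ i s j, S.driftCoef t l i s j = 0) ∧ ∀ i, S.covForward l (t + 1) i (t + 1) i = 0 := by
  induction l with
  | zero => exact ⟨fun i s j => rfl, fun i => by rw [covForward]⟩
  | succ l ih =>
    cases l with
    | zero =>
      refine ⟨fun i s j => ?_, fun i => by rw [covForward]; simp⟩
      simp [driftCoef, χ_eq_zero_of_not_active ht]
    | succ k =>
      have hδ (i : Fin m) (ω : Noise m) (h0 : ω.1 (t + 1) i = 0) :
          S.Zδx (t + 1) (k + 1) i ω = 0 := by
        rw [Zδx_succ, Zh_succ]
        simp [ih.1, h0]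
      have hae (i : Fin m) : ∀ᵐ ω ∂S.lawForward (t + 1) (k + 1), ω.1 (t + 1) i = 0 := by
        rw [lawForward_eq]
        exact ae_law_forward_eq_zero _ _ (covMatrix_forward_posSemidef hφ _ _) (ih.2 i)
      have hδae (i : Fin m) : ∀ᵐ ω ∂S.lawForward (t + 1) (k + 1),
          S.Zδx (t + 1) (k + 1) i ω = 0 := (hae i).mono fun ω => hδ i ω
      refine ⟨fun i s j => ?_, fun i => covForward_diag_eq_zero (hδae i)⟩
      have h1 : ∫ ω, dBackward s j (fun ω' => S.Zδx (t + 1) (k + 1) i ω') ω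
          ∂S.lawForward (t + 1) (k + 1) = 0 := by
        refine integral_eq_zero_of_ae ((hae i).mono fun ω hω => ?_)
        rw [dBackward, lineDeriv]
        have : (fun r : ℝ => S.Zδx (t + 1) (k + 1) i
            (ω + r • ((0, Pi.single s (Pi.single j 1), 0) : Noise m))) = fun _ => 0 := by
          ext r
          exact hδ i _ (by simp [hω])
        rw [this, deriv_const]; rfl
      have h2 : ∫ ω, S.Zx s (k + 1) j ω * S.Zδx (t + 1) (k + 1) i ω
          ∂S.lawForward (t + 1) (k + 1) = 0 :=
        integral_eq_zero_of_ae ((hδae i).mono fun ω hω => by simp [hω])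
      by_cases hs : s = t
      · subst hs; simp [driftCoef, h1, χ_eq_zero_of_not_active ht]
      · simp [driftCoef, h1, h2, hs]

/-! ### Admissible points -/

variable (S) in
/-- The points of the noise space on which relations are tested: in layers `≥ 2` the forward
Gaussians at times that are not fresh vanish; in layer `1` the only forward Gaussians are those of
time `0`, given by `θ ↦ ⟨ξ_i, θ⟩`. -/
def Admissible (l : ℕ) (ω : Noise m) : Prop :=
  (2 ≤ l → ∀ s, ¬ S.Fresh s → ω.1 s = 0) ∧
    (l = 1 → (∀ s, s ≠ 0 → ω.1 s = 0) ∧ ∃ θ, ∀ i, ω.1 0 i = inner ℝ (S.input i) θ)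

theorem admissible_zero {l : ℕ} (hl : 2 ≤ l) (w : ℝ) : S.Admissible l (0, 0, w) :=
  ⟨fun _ _ _ => rfl, fun h => by omega⟩

theorem Admissible.of_forward_eq {l : ℕ} {ω ω' : Noise m} (h : S.Admissible l ω)
    (he : ω'.1 = ω.1) : S.Admissible l ω' := by
  unfold Admissible; rw [he]; exact h

theorem fresh_zero : S.Fresh 0 := Or.inl rfl

theorem fresh_succ_iff {t : ℕ} : S.Fresh (t + 1) ↔ S.Active t := by
  simp [Fresh]

theorem Zh_succ_of_not_active (hφ : ActivationAssumption S.φ) {t l : ℕ} {ω : Noise m}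
    (hω : S.Admissible l ω) (ht : ¬ S.Active t) (i : Fin m) :
    S.Zh (t + 1) l i ω = S.Zh t l i ω := by
  rw [Zh_succ]
  have h1 : (if 2 ≤ l then ω.1 (t + 1) i else 0) = 0 := by
    split_ifs with h
    · rw [hω.1 h _ (by rwa [fresh_succ_iff])]; rfl
    · rfl
  simp [h1, (idle_step hφ ht l).1]

theorem Zδx_eq_zero_of_not_fresh (hφ : ActivationAssumption S.φ) {t l : ℕ} {ω : Noise m}
    (hω : S.Admissible l ω) (ht : ¬ S.Fresh t) (i : Fin m) : S.Zδx t l i ω = 0 := by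
  cases t with
  | zero => exact absurd fresh_zero ht
  | succ t =>
    rw [Zδx_succ, Zh_succ_of_not_active hφ hω (by rwa [fresh_succ_iff] at ht), sub_self]

/-- Beyond the fresh forward Gaussian, `Z^{h_t^l}` depends on earlier variables only. -/
theorem Zh_sub_congr {t l : ℕ} (hl : 2 ≤ l) {ω ω' : Noise m} (h : S.Agree l t t ω ω')
    (i : Fin m) : S.Zh t l i ω - ω.1 t i = S.Zh t l i ω' - ω'.1 t i := by
  cases t with
  | zero => simp [Zh_zero]
  | succ t =>
    have h1 : ∑ s ∈ Finset.range (t + 1), ∑ j, S.driftCoef t l i s j * S.Zdh s l j ω =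
        ∑ s ∈ Finset.range (t + 1), ∑ j, S.driftCoef t l i s j * S.Zdh s l j ω' := by
      refine Finset.sum_congr rfl fun s hs => Finset.sum_congr rfl fun j _ => ?_
      have hs' := Finset.mem_range.1 hs
      by_cases ha : S.Active s
      · rw [Zdh_congr (h.mono (by omega) (by omega)) fun hl => h.2.1 hl s hs' ha]
      · rw [driftCoef_of_not_active ha, zero_mul, zero_mul]
    rw [Zh_succ, Zh_succ, h1, if_pos hl, if_pos hl,
      Zh_congr (h.mono (by omega) (by omega))]
    ring

/-- Beyond the fresh backward Gaussian, `Z^{dx_t^l}` depends on earlier variables only. -/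
theorem Zdx_sub_congr {t l : ℕ} (hl : l < S.depth) {ω ω' : Noise m}
    (h : S.Agree l (t + 1) t ω ω') (i : Fin m) :
    S.Zdx t l i ω - ω.2.1 t i = S.Zdx t l i ω' - ω'.2.1 t i := by
  obtain ⟨b, b', hb⟩ := S.exists_Zdx_eq hl t i
  have hZ : ∀ s ≤ t, ∀ j, S.Zh s l j ω = S.Zh s l j ω' := fun s hs j =>
    Zh_congr (h.mono (by omega) (by omega)) j
  have h1 : ∑ s ∈ Finset.range (t + 1), ∑ j, b s j * S.Zδx s l j ω =
      ∑ s ∈ Finset.range (t + 1), ∑ j, b s j * S.Zδx s l j ω' :=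
    Finset.sum_congr rfl fun s hs => Finset.sum_congr rfl fun j _ => by
      rw [Zδx_congr fun r hr => hZ r (hr.trans (Nat.lt_succ_iff.1 (Finset.mem_range.1 hs)))]
  have h2 : ∑ s ∈ Finset.range t, ∑ j, b' s j * S.φ (S.Zh s l j ω) =
      ∑ s ∈ Finset.range t, ∑ j, b' s j * S.φ (S.Zh s l j ω') :=
    Finset.sum_congr rfl fun s hs => Finset.sum_congr rfl fun j _ => by
      rw [hZ s (Finset.mem_range.1 hs).le]
  rw [hb, hb, h1, h2]
  ring

/-! ### Prescribing values of the variables at admissible points -/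

theorem exists_Zh_eq_of_fresh {l n : ℕ} (hl : 2 ≤ l) (hn : S.Fresh n) {ω : Noise m}
    (hω : S.Admissible l ω) (y : Fin m → ℝ) :
    ∃ ω', S.Admissible l ω' ∧ (∀ p, S.Agree l n p ω ω') ∧ ∀ i, S.Zh n l i ω' = y i := by
  have hag (u : Fin m → ℝ) (p : ℕ) : S.Agree l n p ω (Function.update ω.1 n u, ω.2) :=
    ⟨fun s hs => by simp [hs.ne], fun _ _ _ _ => rfl, rfl⟩
  refine ⟨(Function.update ω.1 n (fun i => y i - (S.Zh n l i ω - ω.1 n i)), ω.2),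
    ⟨fun _ s hs => ?_, fun h => by omega⟩, hag _, fun i => ?_⟩
  · have : s ≠ n := fun h => hs (h ▸ hn)
    simp [this, hω.1 hl s hs]
  · have := Zh_sub_congr hl (hag (fun i => y i - (S.Zh n l i ω - ω.1 n i)) n) i
    simp only [Function.update_self] at this
    linarith

/-- In layers `≥ 2` the pre-activations at any time take arbitrary values, by moving only the
forward Gaussians at the last fresh time `n₀`. -/
theorem exists_Zh_eq (hφ : ActivationAssumption S.φ) {l : ℕ} (hl : 2 ≤ l) (n : ℕ) :
    ∃ n₀ ≤ n, (∀ s, n₀ ≤ s → s < n → ¬ S.Active s) ∧ ∀ ω, S.Admissible l ω → ∀ y : Fin m → ℝ,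
      ∃ ω', S.Admissible l ω' ∧ (∀ p, S.Agree l n₀ p ω ω') ∧ ∀ i, S.Zh n l i ω' = y i := by
  induction n with
  | zero => exact ⟨0, le_rfl, fun s _ h => by omega,
      fun ω hω y => exists_Zh_eq_of_fresh hl fresh_zero hω y⟩
  | succ n ih =>
    by_cases hn : S.Active n
    · exact ⟨n + 1, le_rfl, fun s _ h => by omega,
        fun ω hω y => exists_Zh_eq_of_fresh hl (fresh_succ_iff.2 hn) hω y⟩
    · obtain ⟨n₀, h1, h2, h3⟩ := ih
      refine ⟨n₀, by omega, fun s hs hs' => ?_, fun ω hω y => ?_⟩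
      · rcases (Nat.lt_succ_iff.1 hs').lt_or_eq with h | rfl
        exacts [h2 s hs h, hn]
      · obtain ⟨ω', h4, h5, h6⟩ := h3 ω hω y
        exact ⟨ω', h4, h5, fun i => by rw [Zh_succ_of_not_active hφ h4 hn, h6]⟩

theorem exists_Zdx_eq_value {l n : ℕ} (hl : l < S.depth) {ω : Noise m} (hω : S.Admissible l ω)
    (y : Fin m → ℝ) : ∃ ω', S.Admissible l ω' ∧ ω'.1 = ω.1 ∧ (∀ s, s ≠ n → ω'.2.1 s = ω.2.1 s) ∧
      (∀ p, S.Agree l p n ω ω') ∧ ∀ i, S.Zdx n l i ω' = y i := by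
  have hag (u : Fin m → ℝ) (p : ℕ) :
      S.Agree l p n ω (ω.1, Function.update ω.2.1 n u, ω.2.2) :=
    ⟨fun s hs => rfl, fun _ s hs _ => by simp [hs.ne], rfl⟩
  refine ⟨(ω.1, Function.update ω.2.1 n (fun i => y i - (S.Zdx n l i ω - ω.2.1 n i)), ω.2.2),
    hω.of_forward_eq rfl, rfl, fun s hs => by simp [hs], hag _, fun i => ?_⟩
  have := Zdx_sub_congr hl (hag (fun i => y i - (S.Zdx n l i ω - ω.2.1 n i)) (n + 1)) i
  simp only [Function.update_self] at this
  linarith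

/-- In the first layer the backward Gaussians can be chosen so that all backward variables vanish
before time `n`; the features then stay at their initial values `⟨ξ_i, θ⟩`. -/
theorem exists_Zdx_one_eq_zero (hS : 1 < S.depth) (θ : EuclideanSpace ℝ (Fin d)) (n : ℕ) :
    ∃ ω, S.Admissible 1 ω ∧ (∀ s < n, ∀ i, S.Zdx s 1 i ω = 0) ∧
      ∀ s ≤ n, ∀ i, S.Zh s 1 i ω = inner ℝ (S.input i) θ := by
  suffices h : ∃ ω, S.Admissible 1 ω ∧ (∀ i, ω.1 0 i = inner ℝ (S.input i) θ) ∧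
      ∀ s < n, ∀ i, S.Zdx s 1 i ω = 0 by
    obtain ⟨ω, h1, h2, h3⟩ := h
    refine ⟨ω, h1, h3, fun s hs i => ?_⟩
    induction s with
    | zero => rw [Zh_zero, h2]
    | succ s ih =>
      rw [Zh_succ, ih (by omega), if_neg (by omega), Finset.sum_eq_zero]
      · ring
      · intro r hr
        have := Finset.mem_range.1 hr
        simp [Zdh_eq, h3 r (by omega)]
  induction n with
  | zero =>
    refine ⟨(fun s i => if s = 0 then inner ℝ (S.input i) θ else 0, 0, 0),
      ⟨fun h => by omega, fun _ => ⟨fun s hs => ?_, θ, fun i => by simp⟩⟩, fun i => by simp,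
      fun s hs => by omega⟩
    ext i; simp [hs]
  | succ n ih =>
    obtain ⟨ω, h1, h2, h3⟩ := ih
    obtain ⟨ω', h4, h5, h6, h7, h8⟩ := exists_Zdx_eq_value (n := n) hS h1 0
    refine ⟨ω', h4, by rwa [h5], fun s hs i => ?_⟩
    rcases (Nat.lt_succ_iff.1 hs).lt_or_eq with h | rfl
    · rw [← h3 s h i]
      exact (Zdx_congr ((h7 _).mono le_rfl h.le) (fun _ => (h6 s h.ne).symm) i).symm
    · rw [h8]; rfl

/-! ### Relations among the variables at admissible points -/

/-- Peeling a relation off from its last time. -/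
theorem forall_lt_eq_zero_of_last {n : ℕ} {A : ℕ → Prop} {P : (Noise m) → Prop}
    {f : ℕ → Fin m → Noise m → ℝ}
    (hlast : ∀ n, A n → ∀ c : ℕ → Fin m → ℝ, (∀ s, ¬ A s → c s = 0) →
      (∀ ω, P ω → ∑ s ∈ Finset.range (n + 1), ∑ i, c s i * f s i ω = 0) → c n = 0)
    {c : ℕ → Fin m → ℝ} (hc : ∀ s, ¬ A s → c s = 0)
    (h : ∀ ω, P ω → ∑ s ∈ Finset.range n, ∑ i, c s i * f s i ω = 0) : ∀ s < n, c s = 0 := by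
  induction n with
  | zero => intro s hs; omega
  | succ n ih =>
    have hn : c n = 0 := by
      by_cases hA : A n
      · exact hlast n hA c hc h
      · exact hc n hA
    intro s hs
    rcases (Nat.lt_succ_iff.1 hs).lt_or_eq with h' | rfl
    · refine ih (fun ω hω => ?_) s h'
      have := h ω hω
      rw [Finset.sum_range_succ, hn] at this
      simpa using this
    · exact hn

theorem coeff_Zδx_eq_zero_of_two_le (hφ : ActivationAssumption S.φ) {l n : ℕ} (hl : 2 ≤ l)
    (hn : S.Fresh n) {c : ℕ → Fin m → ℝ}
    (h : ∀ ω, S.Admissible l ω → ∑ s ∈ Finset.range (n + 1), ∑ i, c s i * S.Zδx s l i ω = 0) :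
    c n = 0 := by
  obtain ⟨x, hx⟩ := exists_ne_of_countable_level hφ.countable_level (S.φ 0)
  -- the contribution of the past to `δx_n`
  let P : Fin m → ℝ := fun i => S.Zδx n l i (0, 0, 0) - S.φ (S.Zh n l i (0, 0, 0))
  refine eq_zero_of_sum_comp_eq_const hx (K := -(∑ s ∈ Finset.range n, ∑ i,
    c s i * S.Zδx s l i (0, 0, 0)) - ∑ i, c n i * P i) fun y => ?_
  obtain ⟨ω', h1, h2, h3⟩ := exists_Zh_eq_of_fresh hl hn (admissible_zero hl 0) y
  have h4 := h ω' h1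
  have h5 : ∑ s ∈ Finset.range n, ∑ i, c s i * S.Zδx s l i ω' =
      ∑ s ∈ Finset.range n, ∑ i, c s i * S.Zδx s l i (0, 0, 0) :=
    Finset.sum_congr rfl fun s hs => Finset.sum_congr rfl fun i _ => by
      have hs' := Finset.mem_range.1 hs
      rw [Zδx_congr_of_agree ((h2 n).mono (by omega) (by omega))]
  have h6 (i : Fin m) : S.Zδx n l i ω' = S.φ (y i) + P i := by
    cases n with
    | zero => simp only [P, Zδx_zero, h3]; ring
    | succ n =>
      simp only [P, Zδx_succ, h3, Zh_congr ((h2 n).mono le_rfl le_rfl)]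
      ring
  rw [Finset.sum_range_succ, h5] at h4
  simp only [h6, mul_add, Finset.sum_add_distrib] at h4
  linarith

/-- In the first layer an active step `t` moves the features, at a point where the backward
variables vanish up to time `t`, along the direction of an input `ξ_j` with nonzero error signal. -/
theorem coeff_Zδx_one_eq_zero (hS : 1 < S.depth) (hη : 0 < S.η) (hdata : DataAssumption S.input)
    (hzero : ∀ i, S.input i ≠ 0) (hantipodal : ∀ i j, i ≠ j → S.input i ≠ - S.input j)
    (hφ : ActivationAssumption S.φ) {n : ℕ} (hn : S.Fresh n) {c : ℕ → Fin m → ℝ}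
    (h : ∀ ω, S.Admissible 1 ω → ∑ s ∈ Finset.range (n + 1), ∑ i, c s i * S.Zδx s 1 i ω = 0) :
    c n = 0 := by
  cases n with
  | zero =>
    refine eq_zero_of_sum_activation_inner hφ hdata.injective hzero hantipodal fun θ => ?_
    obtain ⟨ω, h1, -, h3⟩ := exists_Zdx_one_eq_zero hS θ 0
    have := h ω h1
    simpa [Zδx_zero, h3 0 le_rfl] using this
  | succ t =>
    obtain ⟨j, hj⟩ := fresh_succ_iff.1 hn
    have hd : Differentiable ℝ S.φ := hφ.contDiff.differentiable two_ne_zero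
    have key : (fun i => c (t + 1) i * inner ℝ (S.input j) (S.input i)) = 0 := by
      refine eq_zero_of_sum_deriv_activation_inner hφ hdata.injective hzero hantipodal j
        fun θ hθ => ?_
      set q := deriv S.φ (inner ℝ (S.input j) θ) with hq
      let α : Fin m → ℝ := fun i => - (S.η * S.χ t j * inner ℝ (S.input j) (S.input i)) * q
      let u : Fin m → ℝ := fun i => inner ℝ (S.input i) θ
      obtain ⟨ω, h1, h2, h3⟩ := exists_Zdx_one_eq_zero hS θ (t + 1)
      -- the relation at time `t + 1` holds along the curve `y ↦ u + y • α`
      have hcurve (y : ℝ) : ∑ i, c (t + 1) i * S.φ (u i + α i * y) =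
          ∑ i, c (t + 1) i * S.φ (u i) - ∑ s ∈ Finset.range (t + 1), ∑ i,
            c s i * S.Zδx s 1 i ω := by
        obtain ⟨ω', h4, -, -, h7, h8⟩ := exists_Zdx_eq_value (n := t) hS h1 (Pi.single j y)
        have h9 (i : Fin m) : S.Zh t 1 i ω' = u i := by
          rw [← Zh_congr (h7 _) i, h3 t (by omega)]
        have h10 (i : Fin m) : S.Zh (t + 1) 1 i ω' = u i + α i * y := by
          rw [Zh_succ, h9, Finset.sum_range_succ, Finset.sum_eq_zero, Finset.sum_eq_single j]
          · simp only [Zdh_eq, h8, h9, driftCoef, Pi.single_eq_same, if_true, α, u, hq]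
            simp; ring
          · intro k _ hk
            simp [Zdh_eq, h8, hk]
          · simp
          · intro s hs
            simp [driftCoef, (Finset.mem_range.1 hs).ne]
        have h11 := h ω' h4
        rw [Finset.sum_range_succ] at h11
        have h12 : ∑ s ∈ Finset.range (t + 1), ∑ i, c s i * S.Zδx s 1 i ω' =
            ∑ s ∈ Finset.range (t + 1), ∑ i, c s i * S.Zδx s 1 i ω :=
          Finset.sum_congr rfl fun s hs => Finset.sum_congr rfl fun i _ => by
            have hs' := Finset.mem_range.1 hs
            rw [Zδx_congr_of_agree ((h7 (s + 1)).mono le_rfl (by omega))]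
        rw [h12] at h11
        simp only [Zδx_succ, h9, h10, mul_sub, Finset.sum_sub_distrib] at h11
        linarith
      have hder : HasDerivAt (fun y : ℝ => ∑ i, c (t + 1) i * S.φ (u i + α i * y))
          (∑ i, c (t + 1) i * (deriv S.φ (u i + α i * 0) * (α i * 1))) 0 := by
        refine HasDerivAt.fun_sum fun i _ => HasDerivAt.const_mul _ ?_
        exact (hd _).hasDerivAt.comp (0 : ℝ) (((hasDerivAt_id (0 : ℝ)).const_mul (α i)).const_add _)
      rw [funext hcurve] at hder
      have h13 := hder.unique (hasDerivAt_const _ _)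
      have h14 : ∑ i, c (t + 1) i * (deriv S.φ (u i + α i * 0) * (α i * 1)) =
          (- (S.η * S.χ t j * q)) * ∑ i, c (t + 1) i * inner ℝ (S.input j) (S.input i) *
            deriv S.φ (inner ℝ (S.input i) θ) := by
        rw [Finset.mul_sum]
        refine Finset.sum_congr rfl fun i _ => ?_
        simp only [α, u, mul_zero, add_zero]
        ring
      rw [h14] at h13
      exact (mul_eq_zero.1 h13).resolve_left
        (neg_ne_zero.2 (mul_ne_zero (mul_ne_zero hη.ne' hj) hθ))
    ext i
    refine (mul_eq_zero.1 (congrFun key i)).resolve_right ?_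
    by_cases hij : j = i
    · subst hij; exact inner_self_ne_zero.2 (hzero j)
    · exact abs_ne_zero.1 (hdata.abs_inner_ne_zero j i hij)

theorem exists_deriv_Zh_ne_zero (hS : 1 < S.depth) (hzero : ∀ i, S.input i ≠ 0)
    (hφ : ActivationAssumption S.φ) {l : ℕ} (hl : 1 ≤ l) (n : ℕ) (i : Fin m) :
    ∃ ω, S.Admissible l ω ∧ deriv S.φ (S.Zh n l i ω) ≠ 0 := by
  obtain ⟨x, hx⟩ := exists_ne_of_countable_level hφ.countable_level_deriv 0
  rcases hl.lt_or_eq with h | rfl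
  · obtain ⟨n₀, -, -, h3⟩ := exists_Zh_eq hφ h n
    obtain ⟨ω, h4, -, h5⟩ := h3 _ (admissible_zero h 0) fun _ => x
    exact ⟨ω, h4, by rwa [h5]⟩
  · have hi : (inner ℝ (S.input i) (S.input i) : ℝ) ≠ 0 := inner_self_ne_zero.2 (hzero i)
    obtain ⟨ω, h1, -, h3⟩ := exists_Zdx_one_eq_zero hS
      ((x / inner ℝ (S.input i) (S.input i)) • S.input i) n
    refine ⟨ω, h1, ?_⟩
    rw [h3 n le_rfl, inner_smul_right, div_mul_cancel₀ _ hi]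
    exact hx

theorem coeff_Zdh_eq_zero_of_lt (hS : 1 < S.depth) (hzero : ∀ i, S.input i ≠ 0)
    (hφ : ActivationAssumption S.φ) {l n : ℕ} (hl : 1 ≤ l) (hl' : l < S.depth)
    {c : ℕ → Fin m → ℝ}
    (h : ∀ ω, S.Admissible l ω → ∑ s ∈ Finset.range (n + 1), ∑ i, c s i * S.Zdh s l i ω = 0) :
    c n = 0 := by
  ext i
  obtain ⟨ω, hω, hne⟩ := exists_deriv_Zh_ne_zero hS hzero hφ hl n i
  have key : (fun i => c n i * deriv S.φ (S.Zh n l i ω)) = 0 := by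
    refine eq_zero_of_sum_comp_eq_const (g := id) (zero_ne_one (α := ℝ))
      (K := -∑ s ∈ Finset.range n, ∑ i, c s i * S.Zdh s l i ω) fun y => ?_
    obtain ⟨ω', h4, -, h6, h7, h8⟩ := exists_Zdx_eq_value (n := n) hl' hω y
    have h9 := h ω' h4
    have h12 : ∑ s ∈ Finset.range n, ∑ i, c s i * S.Zdh s l i ω' =
        ∑ s ∈ Finset.range n, ∑ i, c s i * S.Zdh s l i ω :=
      Finset.sum_congr rfl fun s hs => Finset.sum_congr rfl fun i _ => by
        have hs' := Finset.mem_range.1 hs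
        rw [Zdh_congr ((h7 (s + 1)).mono le_rfl (by omega)) fun _ => (h6 s hs'.ne).symm]
    have h13 (i : Fin m) : S.Zdh n l i ω' = deriv S.φ (S.Zh n l i ω) * y i := by
      rw [Zdh_eq, h8, Zh_congr (h7 _) i, mul_comm]
    rw [Finset.sum_range_succ, h12] at h9
    simp only [h13] at h9
    simp only [id, mul_assoc]
    linarith
  exact (mul_eq_zero.1 (congrFun key i)).resolve_right hne

theorem ZŴ_eq_of_not_active {n₀ n : ℕ} (hn : n₀ ≤ n)
    (hidle : ∀ s, n₀ ≤ s → s < n → ¬ S.Active s) (ω : Noise m) : S.ZŴ n ω = S.ZŴ n₀ ω := by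
  induction n, hn using Nat.le_induction with
  | base => rfl
  | succ n hn ih =>
    rw [ZŴ_succ, ih fun s h h' => hidle s h (by omega)]
    simp [χ_eq_zero_of_not_active (hidle n hn n.lt_succ_self)]

/-- If step `n` is active, the weight at time `n + 1` is the earlier weight minus
`η ∑ χ_{n,i} φ(h_n^L(ξ_i))`, where `h_n^L` can be moved while the earlier weight is fixed. -/
theorem exists_ZŴ_ne_zero (hS : 1 < S.depth) (hη : 0 < S.η) (hφ : ActivationAssumption S.φ)
    (n : ℕ) : ∃ ω, S.Admissible S.depth ω ∧ S.ZŴ n ω ≠ 0 := by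
  induction n with
  | zero => exact ⟨(0, 0, 1), admissible_zero hS 1, by rw [ZŴ_zero]; exact one_ne_zero⟩
  | succ n ih =>
    by_cases hn : S.Active n
    · by_contra! hall
      obtain ⟨j, hj⟩ := hn
      obtain ⟨x, hx⟩ := exists_ne_of_countable_level hφ.countable_level (S.φ 0)
      obtain ⟨n₀, h1, h2, h3⟩ := exists_Zh_eq hφ hS n
      have key : (fun i => S.η * S.χ n i) = 0 := by
        refine eq_zero_of_sum_comp_eq_const hx (K := S.ZŴ n₀ (0, 0, 0)) fun y => ?_
        obtain ⟨ω', h4, h5, h6⟩ := h3 _ (admissible_zero hS 0) y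
        have := hall ω' h4
        rw [ZŴ_succ, ZŴ_eq_of_not_active h1 h2, ← ZŴ_congr (h5 n₀), sub_eq_zero] at this
        simp only [this, h6, Finset.mul_sum, mul_assoc]
      exact mul_ne_zero hη.ne' hj (congrFun key j)
    · obtain ⟨ω, h1, h2⟩ := ih
      refine ⟨ω, h1, ?_⟩
      rwa [ZŴ_eq_of_not_active n.le_succ fun s h h' => by
        rwa [show s = n by omega]]

/-- The last layer has no fresh backward Gaussians. An active time `n` need not be fresh, but then
`h_n^L` and the last-layer weight agree with those at the last fresh time `n₀ ≤ n`, and the times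
between are inactive and do not enter the relation. -/
theorem coeff_Zdh_depth_eq_zero (hS : 1 < S.depth) (hη : 0 < S.η)
    (hφ : ActivationAssumption S.φ) {n : ℕ} {c : ℕ → Fin m → ℝ}
    (hc : ∀ s, ¬ S.Active s → c s = 0)
    (h : ∀ ω, S.Admissible S.depth ω →
      ∑ s ∈ Finset.range (n + 1), ∑ i, c s i * S.Zdh s S.depth i ω = 0) : c n = 0 := by
  obtain ⟨x, hx⟩ := exists_ne_of_countable_level hφ.countable_level_deriv (deriv S.φ 0)
  obtain ⟨ω, hω, hne⟩ := exists_ZŴ_ne_zero hS hη hφ n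
  obtain ⟨n₀, h1, h2, h3⟩ := exists_Zh_eq hφ hS n
  have key : (fun i => c n i * S.ZŴ n ω) = 0 := by
    refine eq_zero_of_sum_comp_eq_const hx
      (K := -∑ s ∈ Finset.range n, ∑ i, c s i * S.Zdh s S.depth i ω) fun y => ?_
    obtain ⟨ω', h4, h5, h6⟩ := h3 ω hω y
    have h9 := h ω' h4
    have h12 : ∑ s ∈ Finset.range n, ∑ i, c s i * S.Zdh s S.depth i ω' =
        ∑ s ∈ Finset.range n, ∑ i, c s i * S.Zdh s S.depth i ω :=
      Finset.sum_congr rfl fun s hs => Finset.sum_congr rfl fun i _ => by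
        have hs' := Finset.mem_range.1 hs
        by_cases hs₀ : n₀ ≤ s
        · rw [hc s (h2 s hs₀ hs')]; simp
        · rw [Zdh_congr ((h5 s).mono (by omega) le_rfl) fun hl => absurd hl (lt_irrefl _)]
    have h13 (i : Fin m) : S.Zdh n S.depth i ω' = S.ZŴ n ω * deriv S.φ (y i) := by
      rw [Zdh_eq, h6, Zdx_of_le S le_rfl, ZŴ_eq_of_not_active h1 h2 ω',
        ← ZŴ_congr (h5 n₀), ZŴ_eq_of_not_active h1 h2 ω]
    rw [Finset.sum_range_succ, h12] at h9
    simp only [h13] at h9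
    simp only [mul_assoc]
    linarith
  ext i
  exact (mul_eq_zero.1 (congrFun key i)).resolve_right hne

/-! ### Relations that hold almost surely hold at all admissible points -/

variable (S) in
/-- The covariance of the forward Gaussians of layer `l` is nondegenerate on the fresh times
`< n`. -/
def NondegForward (n l : ℕ) : Prop :=
  ∀ c : Fin n × Fin m → ℝ, (∀ p, ¬ S.Fresh p.1 → c p = 0) →
    c ⬝ᵥ (covMatrix n (S.covForward l)).mulVec c = 0 → c = 0

variable (S) in
/-- The covariance of the backward Gaussians of layer `l` is nondegenerate on the active times
`< n`. -/
def NondegBackward (n l : ℕ) : Prop :=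
  ∀ c : Fin n × Fin m → ℝ, (∀ p, ¬ S.Active p.1 → c p = 0) →
    c ⬝ᵥ (covMatrix n (S.covBackward l)).mulVec c = 0 → c = 0

/-- In the first layer, where the covariance is the Gram matrix of the inputs and may be
degenerate, the forward Gaussians take all values `θ ↦ ⟨ξ_i, θ⟩`. -/
theorem exists_sqrtOp_forward_one (n : ℕ) (hφ : ActivationAssumption S.φ)
    (θ : EuclideanSpace ℝ (Fin d)) :
    ∃ x, ∀ s < n, ∀ i, pad n (sqrtOp n (S.covForward 1) x) s i =
      if s = 0 then inner ℝ (S.input i) θ else 0 := by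
  -- only the projection of `θ` to the span of the inputs matters
  let V := Submodule.span ℝ (Set.range S.input)
  obtain ⟨a, ha⟩ := (Submodule.mem_span_range_iff_exists_fun ℝ).1 (V.starProjection_apply_mem θ)
  have hθ (i : Fin m) : inner ℝ (S.input i) θ = ∑ j, inner ℝ (S.input i) (S.input j) * a j := by
    have h1 : inner ℝ (S.input i) θ = inner ℝ (S.input i) (V.starProjection θ) := by
      have := V.starProjection_inner_eq_zero θ (S.input i) (Submodule.subset_span ⟨i, rfl⟩)
      rw [real_inner_comm, inner_sub_right, sub_eq_zero] at this
      exact this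
    rw [h1, ← ha, inner_sum]
    exact Finset.sum_congr rfl fun j _ => by rw [inner_smul_right, mul_comm]
  let c : Fin n × Fin m → ℝ := fun q => if q.1.val = 0 then a q.2 else 0
  refine ⟨sqrtOp n (S.covForward 1) (WithLp.toLp 2 c), fun s hs i => ?_⟩
  rw [pad_of_lt _ hs, sqrtOp_sqrtOp (covMatrix_forward_posSemidef hφ n 1), Matrix.mulVec,
    dotProduct, Fintype.sum_prod_type]
  have hn : 0 < n := by omega
  rw [Finset.sum_eq_single (⟨0, hn⟩ : Fin n)]
  · split_ifs with h
    · rw [hθ]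
      refine Finset.sum_congr rfl fun j _ => ?_
      simp [covMatrix_apply, covForward, h, c]
    · refine Finset.sum_eq_zero fun j _ => ?_
      simp [covMatrix_apply, covForward, h]
  · intro r _ hr
    have : r.val ≠ 0 := fun h => hr (Fin.ext h)
    simp [c, this]
  · simp

/-- A forward Gaussian at a time that is not fresh vanishes. -/
theorem pad_sqrtOp_forward_of_not_fresh (hφ : ActivationAssumption S.φ) (n l : ℕ) {s : ℕ}
    (hs : ¬ S.Fresh s) (i : Fin m) (x : EuclideanSpace ℝ (Fin n × Fin m)) :
    pad n (sqrtOp n (S.covForward l) x) s i = 0 := by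
  cases s with
  | zero => exact absurd fresh_zero hs
  | succ s =>
    have h := ae_law_forward_eq_zero (i := i) 0 (S.covBackward l)
      (covMatrix_forward_posSemidef hφ n l)
      ((idle_step hφ (by rwa [fresh_succ_iff] at hs) l).2 i)
    exact eq_zero_of_ae_law (F := fun ω : Noise m => ω.1 (s + 1) i) (by fun_prop) h x 0 0

/-- If the covariances of a layer are nondegenerate, then a continuous function of the relevant
Gaussian variables that vanishes almost surely vanishes at all admissible points. -/
theorem eq_zero_of_admissible (hφ : ActivationAssumption S.φ) {l n n' : ℕ} (hl : 1 ≤ l)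
    (hF : 2 ≤ l → S.NondegForward n l) (hB : l < S.depth → S.NondegBackward n' l)
    {F : Noise m → ℝ} (hFc : Continuous F)
    (hFa : ∀ ω ω', S.Agree l n n' ω ω' → F ω = F ω')
    (h0 : ∀ᵐ ω ∂law n n' (S.covForward l) (S.covBackward l), F ω = 0)
    {ω : Noise m} (hω : S.Admissible l ω) : F ω = 0 := by
  have hx : ∃ x, ∀ s < n, pad n (sqrtOp n (S.covForward l) x) s = ω.1 s := by
    rcases hl.lt_or_eq with h | rfl
    · obtain ⟨x, hx⟩ := exists_sqrtOp_eq (covMatrix_forward_posSemidef hφ n l) S.Fresh (hF h) ω.1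
      refine ⟨x, fun s hs => ?_⟩
      ext i
      by_cases hf : S.Fresh s
      · exact hx s hs hf i
      · rw [hω.1 h s hf, pad_sqrtOp_forward_of_not_fresh hφ n l hf]; rfl
    · obtain ⟨h1, θ, hθ⟩ := hω.2 rfl
      obtain ⟨x, hx⟩ := exists_sqrtOp_forward_one n hφ θ
      refine ⟨x, fun s hs => ?_⟩
      ext i
      rw [hx s hs]
      split_ifs with h
      · rw [h, hθ]
      · rw [h1 s h]; rfl
  have hx' : ∃ x', l < S.depth → ∀ s < n', S.Active s →
      pad n' (sqrtOp n' (S.covBackward l) x') s = ω.2.1 s := by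
    by_cases h : l < S.depth
    · obtain ⟨x, hx⟩ := exists_sqrtOp_eq (covMatrix_backward_posSemidef hφ n' l) S.Active (hB h)
        ω.2.1
      exact ⟨x, fun _ s hs ha => funext (hx s hs ha)⟩
    · exact ⟨0, fun h' => absurd h' h⟩
  obtain ⟨x, hx⟩ := hx
  obtain ⟨x', hx'⟩ := hx'
  rw [← eq_zero_of_ae_law hFc h0 x x' ω.2.2]
  exact hFa _ _ ⟨fun s hs => (hx s hs).symm, fun hl s hs ha => (hx' hl s hs ha).symm, rfl⟩

section

variable (hS : 1 < S.depth) (hη : 0 < S.η) (hdata : DataAssumption S.input)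
  (hzero : ∀ i, S.input i ≠ 0) (hantipodal : ∀ i j, i ≠ j → S.input i ≠ - S.input j)
  (hφ : ActivationAssumption S.φ)
include hS hη hdata hzero hantipodal hφ

/-- At admissible points there is no linear relation among the increments `Z^{δx_s^l(ξ_i)}` at
fresh times. -/
theorem coeff_Zδx_eq_zero {l n : ℕ} (hl : 1 ≤ l) {c : ℕ → Fin m → ℝ}
    (hc : ∀ s, ¬ S.Fresh s → c s = 0)
    (h : ∀ ω, S.Admissible l ω → ∑ s ∈ Finset.range n, ∑ i, c s i * S.Zδx s l i ω = 0) :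
    ∀ s < n, c s = 0 := by
  refine forall_lt_eq_zero_of_last (fun n hn c _ h => ?_) hc h
  rcases hl.lt_or_eq with hl' | rfl
  · exact coeff_Zδx_eq_zero_of_two_le hφ hl' hn h
  · exact coeff_Zδx_one_eq_zero hS hη hdata hzero hantipodal hφ hn h

omit hdata hantipodal in
/-- At admissible points there is no linear relation among the backward variables
`Z^{dh_s^l(ξ_i)}` at active times. -/
theorem coeff_Zdh_eq_zero {l n : ℕ} (hl : 1 ≤ l) (hl' : l ≤ S.depth) {c : ℕ → Fin m → ℝ}
    (hc : ∀ s, ¬ S.Active s → c s = 0)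
    (h : ∀ ω, S.Admissible l ω → ∑ s ∈ Finset.range n, ∑ i, c s i * S.Zdh s l i ω = 0) :
    ∀ s < n, c s = 0 := by
  refine forall_lt_eq_zero_of_last (fun n _ c hc h => ?_) hc h
  rcases hl'.lt_or_eq with h' | rfl
  · exact coeff_Zdh_eq_zero_of_lt hS hzero hφ hl h' h
  · exact coeff_Zdh_depth_eq_zero hS hη hφ hc h

theorem nondegForward_step {n n' : ℕ} (hn : n ≤ n' + 1)
    (hB : ∀ l, 1 ≤ l → l < S.depth → S.NondegBackward n' l) (k : ℕ) (hk : k + 2 ≤ S.depth) :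
    S.NondegForward n (k + 2) := by
  induction k using Nat.strong_induction_on with
  | _ k ih =>
  refine covMatrix_nondegenerate (fun s i => (regular_Zδx hφ s (k + 1) i).2 _ _ _ _)
    (covForward_eq_integral hφ hn (covMatrix_forward_posSemidef hφ n (k + 1))
      (covMatrix_backward_posSemidef hφ n' (k + 1))) fun c hc h0 => ?_
  refine coeff_Zδx_eq_zero hS hη hdata hzero hantipodal hφ k.succ_pos hc fun ω hω => ?_
  refine eq_zero_of_admissible hφ k.succ_pos (fun h => ?_) (hB (k + 1) k.succ_pos) ?_ ?_ h0 hω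
  · obtain ⟨k, rfl⟩ : ∃ k', k = k' + 1 := ⟨k - 1, by omega⟩
    exact ih k (by omega) (by omega)
  · exact (Regular.sum _ fun s _ => Regular.sum _ fun i _ =>
      (regular_Zδx hφ s (k + 1) i).const_mul _).1
  · intro ω ω' hag
    refine Finset.sum_congr rfl fun s hs => Finset.sum_congr rfl fun i _ => ?_
    have hs' := Finset.mem_range.1 hs
    rw [Zδx_congr_of_agree (hag.mono (by omega) (by omega))]

omit hdata hantipodal in
theorem nondegBackward_step {n : ℕ} (hF : ∀ k, k + 2 ≤ S.depth → S.NondegForward n (k + 2))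
    (q l : ℕ) (hl : 1 ≤ l) (hl' : l < S.depth) (hq : S.depth ≤ l + q) :
    S.NondegBackward n l := by
  induction q generalizing l with
  | zero => omega
  | succ q ih =>
    refine covMatrix_nondegenerate (fun s i => (regular_Zdh hφ s (l + 1) i).2 _ _ _ _)
      (covBackward_eq_integral hφ le_rfl hl' (covMatrix_forward_posSemidef hφ n (l + 1))
        (covMatrix_backward_posSemidef hφ n (l + 1))) fun c hc h0 => ?_
    refine coeff_Zdh_eq_zero hS hη hzero hφ l.succ_pos hl' hc fun ω hω => ?_
    refine eq_zero_of_admissible hφ l.succ_pos (fun _ => ?_)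
      (fun h => ih (l + 1) l.succ_pos h (by omega)) ?_ ?_ h0 hω
    · obtain ⟨k, rfl⟩ : ∃ k, l = k + 1 := ⟨l - 1, by omega⟩
      exact hF k hl'
    · exact (Regular.sum _ fun s _ => Regular.sum _ fun i _ =>
        (regular_Zdh hφ s (l + 1) i).const_mul _).1
    · intro ω ω' hag
      refine Finset.sum_congr rfl fun s hs => Finset.sum_congr rfl fun i _ => ?_
      have hs' := Finset.mem_range.1 hs
      by_cases ha : S.Active s
      · rw [Zdh_congr (hag.mono (by omega) (by omega)) fun h => hag.2.1 h s hs' ha]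
      · simp [hc s ha]

theorem nondegBackward (n l : ℕ) (hl : 1 ≤ l) (hl' : l < S.depth) : S.NondegBackward n l := by
  induction n generalizing l with
  | zero => exact fun c _ _ => funext fun p => p.1.elim0
  | succ n ih =>
    exact nondegBackward_step hS hη hzero hφ
      (nondegForward_step hS hη hdata hzero hantipodal hφ le_rfl ih) S.depth l hl hl' (by omega)

theorem eq_zero_of_ae_lawForward {t l : ℕ} (hl : 1 ≤ l) (hl' : l ≤ S.depth) {F : Noise m → ℝ}
    (hFc : Continuous F) (hFa : ∀ ω ω', S.Agree l (t + 1) t ω ω' → F ω = F ω')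
    (h0 : ∀ᵐ ω ∂S.lawForward t l, F ω = 0) {ω : Noise m} (hω : S.Admissible l ω) : F ω = 0 := by
  have hB := nondegBackward hS hη hdata hzero hantipodal hφ t
  rw [lawForward_eq] at h0
  refine eq_zero_of_admissible hφ hl (fun h => ?_) (hB l hl) hFc hFa h0 hω
  obtain ⟨k, rfl⟩ : ∃ k, l = k + 2 := ⟨l - 2, by omega⟩
  exact nondegForward_step hS hη hdata hzero hantipodal hφ le_rfl hB k hl'

omit hη hdata hzero hantipodal in
theorem coeff_Zh_eq_zero {t l : ℕ} (hl : 1 ≤ l)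
    (hξ : l = 1 → LinearIndependent ℝ S.input) {c : Fin m → ℝ}
    (h : ∀ ω, S.Admissible l ω → ∑ i, c i * S.Zh t l i ω = 0) : c = 0 := by
  rcases hl.lt_or_eq with hl' | rfl
  · obtain ⟨n₀, -, -, h3⟩ := exists_Zh_eq hφ hl' t
    refine eq_zero_of_sum_comp_eq_const (g := id) (zero_ne_one (α := ℝ)) (K := 0) fun y => ?_
    obtain ⟨ω, h4, -, h6⟩ := h3 _ (admissible_zero hl' 0) y
    simpa [h6] using h ω h4
  · have h1 (θ : EuclideanSpace ℝ (Fin d)) : inner ℝ (∑ i, c i • S.input i) θ = 0 := by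
      obtain ⟨ω, h4, -, h6⟩ := exists_Zdx_one_eq_zero hS θ t
      simpa [h6 t le_rfl, sum_inner, inner_smul_left] using h ω h4
    have h2 := Fintype.linearIndependent_iff.1 (hξ rfl) c (inner_self_eq_zero.1 (h1 _))
    exact funext h2

/-- The features at time `t` are the sums of their increments, and only those at fresh times
contribute. -/
theorem coeff_Zx_eq_zero {t l : ℕ} (hl : 1 ≤ l) {c : Fin m → ℝ}
    (h : ∀ ω, S.Admissible l ω → ∑ i, c i * S.Zx t l i ω = 0) : c = 0 := by
  classical
  have htel (i : Fin m) (ω : Noise m) :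
      S.Zx t l i ω = ∑ s ∈ Finset.range (t + 1), S.Zδx s l i ω := by
    rw [Zx_eq, Finset.sum_range_succ', Zδx_zero]
    simp only [Zδx_succ]
    rw [Finset.sum_range_sub (fun s => S.φ (S.Zh s l i ω)), sub_add_cancel]
  have := coeff_Zδx_eq_zero hS hη hdata hzero hantipodal hφ hl (n := t + 1)
    (c := fun s => if S.Fresh s then c else 0) (fun s hs => if_neg hs) (fun ω hω => ?_) 0
    t.succ_pos
  · simpa [fresh_zero] using this
  · rw [← h ω hω]
    simp only [htel, Finset.mul_sum]
    rw [Finset.sum_comm]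
    refine Finset.sum_congr rfl fun i _ => Finset.sum_congr rfl fun s _ => ?_
    by_cases hs : S.Fresh s
    · simp [hs]
    · simp [Zδx_eq_zero_of_not_fresh hφ hω hs]

theorem aeLinearIndependent_Zh {t l : ℕ} (hl : 1 ≤ l) (hl' : l ≤ S.depth)
    (hξ : l = 1 → LinearIndependent ℝ S.input) :
    AELinearIndependent (S.lawForward t l) (fun i => S.Zh t l i) := by
  refine aeLinearIndependent_of_forall fun c hc => ?_
  refine coeff_Zh_eq_zero hS hφ (t := t) hl hξ fun ω hω => ?_
  refine eq_zero_of_ae_lawForward hS hη hdata hzero hantipodal hφ hl hl' ?_ ?_ hc hω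
  · exact (Regular.sum _ fun i _ => (regular_Zh hφ t l i).const_mul _).1
  · exact fun ω ω' h => Finset.sum_congr rfl fun i _ => by rw [Zh_congr h]

theorem aeLinearIndependent_Zx {t l : ℕ} (hl : 1 ≤ l) (hl' : l ≤ S.depth) :
    AELinearIndependent (S.lawForward t l) (fun i => S.Zx t l i) := by
  refine aeLinearIndependent_of_forall fun c hc => ?_
  refine coeff_Zx_eq_zero hS hη hdata hzero hantipodal hφ (t := t) hl fun ω hω => ?_
  refine eq_zero_of_ae_lawForward hS hη hdata hzero hantipodal hφ hl hl' ?_ ?_ hc hω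
  · simp only [Zx_eq]
    exact (Regular.sum _ fun i _ => ((regular_Zh hφ t l i).activation hφ).const_mul _).1
  · exact fun ω ω' h => Finset.sum_congr rfl fun i _ => by rw [Zx_eq, Zx_eq, Zh_congr h]

end

end TrainingSetup

end

theorem theorem1 {d m : ℕ} (S : TrainingSetup d m)
    (hdepth : 1 < S.depth) (hη : 0 < S.η)
    (hloss : ∀ y : ℝ, ContDiff ℝ 1 (fun z => S.loss z y))
    (hdata : DataAssumption S.input)
    (hzero : ∀ i, S.input i ≠ 0)
    (hantipodal : ∀ i j, i ≠ j → S.input i ≠ - S.input j)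
    (hφ : ActivationAssumption S.φ) :
    ∀ t l : ℕ, 1 ≤ l → l ≤ S.depth →
      ((l = 1 → LinearIndependent ℝ S.input) →
        AELinearIndependent (S.lawForward t l) (fun i => S.Zh t l i)) ∧
      AELinearIndependent (S.lawForward t l) (fun i => S.Zx t l i) := by
  intro t l hl hl'
  exact ⟨TrainingSetup.aeLinearIndependent_Zh hdepth hη hdata hzero hantipodal hφ hl hl',
    TrainingSetup.aeLinearIndependent_Zx hdepth hη hdata hzero hantipodal hφ hl hl'⟩
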